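/- Let $\epsilon,\mu_1,\mu_2,a,L,\delta_1,\delta_2,\delta_3>0$, $\theta,\xi,b\in\mathbb R$ and $n\in\{0,1,2,\dots\}$, with $\lambda_1<\lambda_2<\lambda_3$ where $\lambda_1=\frac1{\sqrt\epsilon}$, $\lambda_2=\frac1{\sqrt{\mu_1}}$, $\lambda_3=\frac1{\sqrt{\mu_2}}$. Put $\kappa=\frac{n\pi}{L}$, $\tau=\kappa^2+\frac a\epsilon$, $\bar c_1=\frac{\xi}{2\sqrt\epsilon}+\frac{\theta}{2\epsilon}$, $\bar c_2=\frac{\xi}{2\sqrt\epsilon}-\frac{\theta}{2\epsilon}$, $c_1(x)=\bar c_2e^{\sqrt\epsilon(\bar c_1-\bar c_2)x}$, $c_2(x)=-\frac{1}{2\sqrt\epsilon}e^{\sqrt\epsilon\bar c_1x}$, $c_3(x)=-\bar c_1e^{-\sqrt\epsilon(\bar c_1-\bar c_2)x}$, $c_4(x)=\frac1{2\sqrt\epsilon}e^{\sqrt\epsilon\bar c_2x}$, $c_5(x)=e^{-\sqrt\epsilon\bar c_1x}$, $c_6(x)=e^{-\sqrt\epsilon\bar c_2x}$, $f_{11}(x,y)=e^{\sqrt\epsilon\bar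 c_1(x-y)}$, $f_{12}(x,y)=e^{\sqrt\epsilon(\bar c_1x-\bar c_2y)}$, $f_{21}(x,y)=e^{\sqrt\epsilon(\bar c_2x-\bar c_1y)}$, $f_{22}(x,y)=e^{\sqrt\epsilon\bar c_2(x-y)}$, and $$\Sigma=\mathrm{diag}(\lambda_1,\lambda_2,\lambda_3),\quad A=\begin{bmatrix}0&-\lambda_1&0\\0&0&0\\0&\kappa\lambda_3&0\end{bmatrix},\quad C=-I,\quad D=\begin{bmatrix}0&2&0\\0&0&0\\0&-2\kappa&0\end{bmatrix},$$ $$F_{11}=\begin{bmatrix}\frac{c_1}2&c_2&0\\\frac{a(c_5+c_6)}{4\epsilon\sqrt{\mu_1}}&0&-\frac{\kappa}{2\sqrt{\mu_1}}\\0&\frac{\kappa}{2\sqrt{\mu_2}}&0\end{bmatrix},\quad F_{12}=\begin{bmatrix}-\frac{c_1}2&0&0\\\frac{a(c_5-c_6)}{4\epsilon\sqrt{\mu_1}}&0&0\\0&0&0\end{bmatrix},$$ $$F_{21}=\begin{bmatrix}\frac{c_3}2&c_4&0\\-\frac{a(c_5+c_6)}{4\epsilon\sqrt{\mu_1}}&0&\frac{\kappa}{2\sqrt{\mu_1}}\\0&-\frac{\kappa}{2\sqrt{\mu_2}}&0\end{bmatrix},\quad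 F_{22}=\begin{bmatrix}\frac{c_3}2&0&0\\-\frac{a(c_5-c_6)}{4\epsilon\sqrt{\mu_1}}&0&0\\0&0&0\end{bmatrix},$$ $$F_{13}(x)=\begin{bmatrix}2\kappa^2c_2(x)&0&-2\kappa c_2(x)\\0&-\frac{\tau}{\sqrt{\mu_1}}&0\\\frac{a\kappa}{\epsilon\sqrt{\mu_2}}&0&-\frac{\tau}{\sqrt{\mu_2}}\end{bmatrix},\quad F_{23}(x)=\begin{bmatrix}2\kappa^2c_4(x)&0&-2\kappa c_4(x)\\0&\frac{\tau}{\sqrt{\mu_1}}&0\\-\frac{a\kappa}{\epsilon\sqrt{\mu_2}}&0&\frac{\tau}{\sqrt{\mu_2}}\end{bmatrix},$$ $$F_{14}(x,y)=\begin{bmatrix}-\frac{\kappa^2}{2\sqrt\epsilon}f_{11}(x,y)&0&-\kappa c_2(x)\\0&-\frac{\tau}{2\sqrt{\mu_1}}&0\\\frac{a\kappa}{2\epsilon\sqrt{\mu_2}}c_5(y)&0&-\frac{\tau}{2\sqrt{\mu_2}}\end{bmatrix},\quad F_{24}(x,y)=\begin{bmatrix}\frac{\kappa^2}{2\sqrt\epsilon}f_{21}(x,y)&0&-\kappa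 c_4(x)\\0&\frac{\tau}{2\sqrt{\mu_1}}&0\\-\frac{a\kappa}{2\epsilon\sqrt{\mu_2}}c_5(y)&0&\frac{\tau}{2\sqrt{\mu_2}}\end{bmatrix},$$ and let $F_{15}$ (resp. $F_{25}$) be $F_{14}$ (resp. $F_{24}$) with $f_{11},c_5$ replaced by $f_{12},c_6$ (resp. $f_{21},c_5$ by $f_{22},c_6$). Let $\Gamma=\{(x,y):0\le y\le x\le1\}$ and consider the following equations for $3\times3$ matrix functions $K=(k_{ij})$, $L=(l_{ij})$ on $\Gamma$ and $\Phi=(\phi_{ij})$ on $[0,1]$ (these are the kernels $K_n,L_n,\Phi_n$; the matrix function $L(x,y)$ is not to be confused with the length $L$): $$\Sigma L_x-L_y\Sigma=K(F_{11}-F_{12})(y)+L(F_{21}-F_{22})(y)-\Omega(x)L-F_{15}(x,y)+\int_y^x[K(x,s)F_{15}(s,y)+L(x,s)F_{25}(s,y)]ds,$$ $$\Sigma K_x+K_y\Sigma=K(F_{11}+F_{12})(y)+L(F_{21}+F_{22})(y)-\Omega(x)K-F_{14}(x,y)+\int_y^x[K(x,s)F_{14}(s,y)+L(x,s)F_{24}(s,y)]ds,$$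 $$\Phi'=\Sigma^{-1}\Phi A-\Sigma^{-1}F_{13}-\Sigma^{-1}\Omega\Phi+\Sigma^{-1}L(x,0)\Sigma D+\int_0^x\Sigma^{-1}[K(x,y)F_{13}(y)+L(x,y)F_{23}(y)]dy,$$ where $\Omega(x)$ is strictly upper triangular with $\omega_{12}(x)=(\lambda_1-\lambda_2)k_{12}(x,x)+c_2(x)$, $\omega_{13}(x)=(\lambda_1-\lambda_3)k_{13}(x,x)$, $\omega_{23}(x)=(\lambda_2-\lambda_3)k_{23}(x,x)-\frac{\kappa}{2\sqrt{\mu_1}}$, with the conditions, for $x\in[0,1]$, $$\Sigma L(x,x)+L(x,x)\Sigma=-(F_{11}-F_{12})(x),\qquad \Sigma K(x,x)-K(x,x)\Sigma=-(F_{11}+F_{12})(x)+\Omega(x),$$ $$K(x,0)\Sigma-L(x,0)\Sigma C=\Phi(x)\Sigma,\qquad \Phi(0)=\begin{bmatrix}-\delta_1\sqrt\epsilon&1&0\\0&-\delta_2\sqrt{\mu_1}&0\\0&b&-\delta_3\sqrt{\mu_2}\end{bmatrix},$$ where the condition on $K(x,0)$ is imposed for $0<x\le1$ and, in the entries $i\le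 j$, also at $x=0$ (at the corner, the entries $i>j$ of $K$ are prescribed by the condition on the diagonal $y=x$). A bounded solution is a triple $(K,L,\Phi)$ of bounded functions, with $K,L$ Borel measurable on $\Gamma$, that satisfies these conditions pointwise and the equations along characteristics: on every segment $t\mapsto(x+\lambda_it,y-\lambda_jt)$ (resp. $t\mapsto(x+\lambda_it,y+\lambda_jt)$), $t\in[0,T]$, contained in $\Gamma$, the function $l_{ij}$ (resp. $k_{ij}$) is absolutely continuous and its derivative in $t$ equals, for almost every $t$, the $(i,j)$ entry of the right-hand side of the first (resp. second) equation; and $\Phi$ is absolutely continuous on $[0,1]$ and satisfies the third equation almost everywhere. Then there exists a unique bounded solution $(K,L,\Phi)$ (any two coincide at every point of $\Gamma$, resp. $[0,1]$), and there is $M>0$ such that for all $i,j\in\{1,2,3\}$, $$|k_{ij}(x,y)|\le Me^{Mx},\quad|l_{ij}(x,y)|\le Me^{Mx}\quad((x,y)\in\Gamma),\qquad|\phi_{ij}(x)|\le Me^{Mx}\quad(x\in[0,1]).$$ -/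

import Mathlib

open MeasureTheory

noncomputable section

/-- Dimensionless parameters of the plate; `ℓ` is the aspect ratio, usually written `L`. -/
structure PlateParams where
  ε : ℝ
  μ₁ : ℝ
  μ₂ : ℝ
  a : ℝ
  θ : ℝ
  ξ : ℝ
  ℓ : ℝ

/-- Real `3 × 3` matrices. -/
abbrev Mat3 : Type := Matrix (Fin 3) (Fin 3) ℝ

namespace PlateParams

variable (P : PlateParams) (n : ℕ)

/-- The wave number `n π / L` of the mode `n`. -/
def κ : ℝ := n * Real.pi / P.ℓ

def cbar₁ : ℝ := P.ξ / (2 * √P.ε) + P.θ / (2 * P.ε)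

def cbar₂ : ℝ := P.ξ / (2 * √P.ε) - P.θ / (2 * P.ε)

def c₁ (x : ℝ) : ℝ := P.cbar₂ * Real.exp (√P.ε * (P.cbar₁ - P.cbar₂) * x)

def c₂ (x : ℝ) : ℝ := -(1 / (2 * √P.ε)) * Real.exp (√P.ε * P.cbar₁ * x)

def c₃ (x : ℝ) : ℝ := -P.cbar₁ * Real.exp (-√P.ε * (P.cbar₁ - P.cbar₂) * x)

def c₄ (x : ℝ) : ℝ := 1 / (2 * √P.ε) * Real.exp (√P.ε * P.cbar₂ * x)

def c₅ (x : ℝ) : ℝ := Real.exp (-√P.ε * P.cbar₁ * x)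

def c₆ (x : ℝ) : ℝ := Real.exp (-√P.ε * P.cbar₂ * x)

def f₁₁ (x y : ℝ) : ℝ := Real.exp (√P.ε * P.cbar₁ * (x - y))

def f₁₂ (x y : ℝ) : ℝ := Real.exp (√P.ε * (P.cbar₁ * x - P.cbar₂ * y))

def f₂₁ (x y : ℝ) : ℝ := Real.exp (√P.ε * (P.cbar₂ * x - P.cbar₁ * y))

def f₂₂ (x y : ℝ) : ℝ := Real.exp (√P.ε * P.cbar₂ * (x - y))

/-- The transport speeds, the diagonal entries of `Σ`. -/
def lam : Fin 3 → ℝ := ![1 / √P.ε, 1 / √P.μ₁, 1 / √P.μ₂]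

/-- The matrix `Σ`. -/
def Sig : Mat3 := Matrix.diagonal P.lam

def A : Mat3 :=
  !![0, -(1 / √P.ε), 0;
     0, 0, 0;
     0, P.κ n / √P.μ₂, 0]

def C : Mat3 :=
  !![-1, 0, 0;
     0, -1, 0;
     0, 0, -1]

def D : Mat3 :=
  !![0, 2, 0;
     0, 0, 0;
     0, -(2 * P.κ n), 0]

def F11 (x : ℝ) : Mat3 :=
  !![P.c₁ x / 2, P.c₂ x, 0;
     P.a * (P.c₅ x + P.c₆ x) / (4 * P.ε * √P.μ₁), 0, -(P.κ n / (2 * √P.μ₁));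
     0, P.κ n / (2 * √P.μ₂), 0]

def F12 (x : ℝ) : Mat3 :=
  !![-(P.c₁ x / 2), 0, 0;
     P.a * (P.c₅ x - P.c₆ x) / (4 * P.ε * √P.μ₁), 0, 0;
     0, 0, 0]

def F21 (x : ℝ) : Mat3 :=
  !![P.c₃ x / 2, P.c₄ x, 0;
     -(P.a * (P.c₅ x + P.c₆ x) / (4 * P.ε * √P.μ₁)), 0, P.κ n / (2 * √P.μ₁);
     0, -(P.κ n / (2 * √P.μ₂)), 0]

def F22 (x : ℝ) : Mat3 :=
  !![P.c₃ x / 2, 0, 0;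
     -(P.a * (P.c₅ x - P.c₆ x) / (4 * P.ε * √P.μ₁)), 0, 0;
     0, 0, 0]

/-- The number `(n² π² ε + a L²) / (ε L²) = (n π / L)² + a / ε`. -/
def τ : ℝ := (n ^ 2 * Real.pi ^ 2 * P.ε + P.a * P.ℓ ^ 2) / (P.ε * P.ℓ ^ 2)

def F13 (x : ℝ) : Mat3 :=
  !![2 * P.κ n ^ 2 * P.c₂ x, 0, -(2 * P.κ n * P.c₂ x);
     0, -(P.τ n / √P.μ₁), 0;
     P.a * P.κ n / (P.ε * √P.μ₂), 0, -(P.τ n / √P.μ₂)]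

def F14 (x y : ℝ) : Mat3 :=
  !![-(P.κ n ^ 2 / (2 * √P.ε) * P.f₁₁ x y), 0, -(P.κ n * P.c₂ x);
     0, -(P.τ n / (2 * √P.μ₁)), 0;
     P.a * P.κ n / (2 * P.ε * √P.μ₂) * P.c₅ y, 0, -(P.τ n / (2 * √P.μ₂))]

def F15 (x y : ℝ) : Mat3 :=
  !![-(P.κ n ^ 2 / (2 * √P.ε) * P.f₁₂ x y), 0, -(P.κ n * P.c₂ x);
     0, -(P.τ n / (2 * √P.μ₁)), 0;
     P.a * P.κ n / (2 * P.ε * √P.μ₂) * P.c₆ y, 0, -(P.τ n / (2 * √P.μ₂))]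

def F23 (x : ℝ) : Mat3 :=
  !![2 * P.κ n ^ 2 * P.c₄ x, 0, -(2 * P.κ n * P.c₄ x);
     0, P.τ n / √P.μ₁, 0;
     -(P.a * P.κ n / (P.ε * √P.μ₂)), 0, P.τ n / √P.μ₂]

def F24 (x y : ℝ) : Mat3 :=
  !![P.κ n ^ 2 / (2 * √P.ε) * P.f₂₁ x y, 0, -(P.κ n * P.c₄ x);
     0, P.τ n / (2 * √P.μ₁), 0;
     -(P.a * P.κ n / (2 * P.ε * √P.μ₂) * P.c₅ y), 0, P.τ n / (2 * √P.μ₂)]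

def F25 (x y : ℝ) : Mat3 :=
  !![P.κ n ^ 2 / (2 * √P.ε) * P.f₂₂ x y, 0, -(P.κ n * P.c₄ x);
     0, P.τ n / (2 * √P.μ₁), 0;
     -(P.a * P.κ n / (2 * P.ε * √P.μ₂) * P.c₆ y), 0, P.τ n / (2 * √P.μ₂)]

/-- The initial value `Φ(0)`, with an arbitrary entry `b` in position `(3, 2)`. -/
def Phi0 (δ₁ δ₂ δ₃ b : ℝ) : Mat3 :=
  !![-δ₁ * √P.ε, 1, 0;
     0, -δ₂ * √P.μ₁, 0;
     0, b, -δ₃ * √P.μ₂]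

/-- The strictly upper triangular matrix `Ω(x)`, built from the trace of `K` on the diagonal. -/
def Om (K : ℝ → ℝ → Mat3) (x : ℝ) : Mat3 :=
  !![0, (1 / √P.ε - 1 / √P.μ₁) * K x x 0 1 + P.c₂ x, (1 / √P.ε - 1 / √P.μ₂) * K x x 0 2;
     0, 0, (1 / √P.μ₁ - 1 / √P.μ₂) * K x x 1 2 - P.κ n / (2 * √P.μ₁);
     0, 0, 0]

/-- Right-hand side of the equation for `Σ L_x - L_y Σ`. -/
def rhsL (K L : ℝ → ℝ → Mat3) (x y : ℝ) : Mat3 :=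
  K x y * (P.F11 n y - P.F12 y) + L x y * (P.F21 n y - P.F22 y)
    - P.Om n K x * L x y - P.F15 n x y
    + Matrix.of fun i j => ∫ s in y..x, (K x s * P.F15 n s y + L x s * P.F25 n s y) i j

/-- Right-hand side of the equation for `Σ K_x + K_y Σ`. -/
def rhsK (K L : ℝ → ℝ → Mat3) (x y : ℝ) : Mat3 :=
  K x y * (P.F11 n y + P.F12 y) + L x y * (P.F21 n y + P.F22 y)
    - P.Om n K x * K x y - P.F14 n x y
    + Matrix.of fun i j => ∫ s in y..x, (K x s * P.F14 n s y + L x s * P.F24 n s y) i j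

/-- Right-hand side of the equation for `Φ_x`. -/
def rhsPhi (K L : ℝ → ℝ → Mat3) (Φ : ℝ → Mat3) (x : ℝ) : Mat3 :=
  P.Sig⁻¹ * Φ x * P.A n - P.Sig⁻¹ * P.F13 n x - P.Sig⁻¹ * P.Om n K x * Φ x
    + P.Sig⁻¹ * L x 0 * P.Sig * P.D n
    + Matrix.of fun i j =>
        ∫ y in (0 : ℝ)..x, (P.Sig⁻¹ * (K x y * P.F13 n y + L x y * P.F23 n y)) i j

end PlateParams

/-- The triangle `0 ≤ y ≤ x ≤ 1`. -/
def Tri : Set (ℝ × ℝ) := {p | 0 ≤ p.2 ∧ p.2 ≤ p.1 ∧ p.1 ≤ 1}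

/-- `u` is a Carathéodory solution of `u' = g` on `[0, T]`: it is absolutely continuous there and
satisfies the equation at almost every point. -/
def CaratheodoryOn (u g : ℝ → ℝ) (T : ℝ) : Prop :=
  AbsolutelyContinuousOnInterval u 0 T ∧
    ∀ᵐ t : ℝ, t ∈ Set.Ioo 0 T → HasDerivAt u (g t) t

/-- `u` is a broad solution of `p u_x + q u_y = g` on the triangle: along every characteristic
segment `t ↦ (x + p t, y + q t)` contained in the triangle, `u` is absolutely continuous and its
derivative in `t` is `g` almost everywhere. -/
def IsBroadSolution (p q : ℝ) (u g : ℝ → ℝ → ℝ) : Prop :=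
  ∀ x y T : ℝ, 0 ≤ T → (x, y) ∈ Tri → (x + p * T, y + q * T) ∈ Tri →
    CaratheodoryOn (fun t => u (x + p * t) (y + q * t)) (fun t => g (x + p * t) (y + q * t)) T

/-- `(K, L, Φ)` is a bounded solution of the kernel equations on the triangle and on `[0, 1]`. The
values of `K`, `L`, `Φ` outside of these sets play no role. -/
structure IsBoundedKernelSolution (P : PlateParams) (n : ℕ) (Φ₀ : Mat3)
    (K L : ℝ → ℝ → Mat3) (Φ : ℝ → Mat3) : Prop where
  measurable_K : ∀ i j, Measurable fun p : Tri => K p.1.1 p.1.2 i j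
  measurable_L : ∀ i j, Measurable fun p : Tri => L p.1.1 p.1.2 i j
  bounded : ∃ B : ℝ, ∀ i j,
    (∀ x y, (x, y) ∈ Tri → |K x y i j| ≤ B ∧ |L x y i j| ≤ B) ∧
      ∀ x ∈ Set.Icc (0 : ℝ) 1, |Φ x i j| ≤ B
  /-- `Σ L_x - L_y Σ = rhsL`, entry by entry. -/
  eq_L : ∀ i j, IsBroadSolution (P.lam i) (-P.lam j)
    (fun x y => L x y i j) (fun x y => P.rhsL n K L x y i j)
  /-- `Σ K_x + K_y Σ = rhsK`, entry by entry. -/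
  eq_K : ∀ i j, IsBroadSolution (P.lam i) (P.lam j)
    (fun x y => K x y i j) (fun x y => P.rhsK n K L x y i j)
  /-- `Φ_x = rhsPhi`, entry by entry. -/
  eq_Phi : ∀ i j, CaratheodoryOn (fun x => Φ x i j) (fun x => P.rhsPhi n K L Φ x i j) 1
  bc_L_diag : ∀ x ∈ Set.Icc (0 : ℝ) 1,
    P.Sig * L x x + L x x * P.Sig = -(P.F11 n x - P.F12 x)
  bc_K_diag : ∀ x ∈ Set.Icc (0 : ℝ) 1,
    P.Sig * K x x - K x x * P.Sig = -(P.F11 n x + P.F12 x) + P.Om n K x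
  /-- At the corner `(0, 0)` the entries below the diagonal are already prescribed by `bc_K_diag`,
  with values that are in general different (these entries of `K` are discontinuous there). -/
  bc_K_bottom : ∀ x ∈ Set.Icc (0 : ℝ) 1, ∀ i j, (0 < x ∨ i ≤ j) →
    (K x 0 * P.Sig - L x 0 * P.Sig * PlateParams.C) i j = (Φ x * P.Sig) i j
  init_Phi : Φ 0 = Φ₀

end

/-!
Integrated along the characteristics, the kernel equations become a system of Volterra type: each
entry at `(x, y)` equals a boundary value plus the integral of the right-hand side along the
backward characteristic (`IsIntegralSolution`). For the entries of `K` below the diagonal the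
characteristic may start on the diagonal or on the bottom edge (`FromDiag`), which makes these
entries discontinuous in general. Everything is therefore carried out with bounded measurable
functions, estimated pointwise, and not with continuous ones.

The right-hand side is quadratic through the product `Ω K`, but `Ω` is strictly upper triangular and
its row `i` is built from row `i` of `K` only. Hence row `i` of the right-hand side is affine in
row `i` of the unknowns, with coefficients that depend on the rows below `i`
(`exists_rhs_sub_le`). So `Ω` is built from one family `w` and the factor on its right is taken from
another one, `w'`. All characteristics move to the right with positive speed, so for fixed
`w'` the integral operator is a contraction on each row in a norm with weight `e ^ (-M x)`, provided
that the bottom values of `K` are computed from the updated `Φ` and `L`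
(`exists_step_contraction`). Picard iteration solves the affine problem
(`exists_isIntegralSolution_of_snd`), and the contraction shows that row `i` of the solution depends
only on the rows of `w'` below `i` (`IsIntegralSolution.closeOnRow_zero`). Feeding the solution back
as `w'` a few times makes all the rows stationary, from the last one to the first
(`exists_isIntegralSolution`); the same induction on the rows gives uniqueness
(`IsIntegralSolution.unique`).

The integral form is equivalent to the original one by the Lebesgue differentiation theorem and the
fundamental theorem of calculus for absolutely continuous functions. As `x` ranges over `[0, 1]`,
the exponential bound is equivalent to boundedness.
-/

/-! ### Absolutely continuous solutions and parametric integrals -/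

lemma intervalIntegrable_of_abs_le {f : ℝ → ℝ} {a b B : ℝ} (hab : a ≤ b) (hf : Measurable f)
    (hB : ∀ s ∈ Set.Icc a b, |f s| ≤ B) : IntervalIntegrable f volume a b := by
  rw [intervalIntegrable_iff_integrableOn_Icc_of_le hab]
  refine Measure.integrableOn_of_bounded (M := B) (by simp) hf.aestronglyMeasurable ?_
  filter_upwards [ae_restrict_mem measurableSet_Icc] with s hs using hB s hs

lemma caratheodoryOn_of_eq_integral {u g : ℝ → ℝ} {T c : ℝ} (hT : 0 ≤ T)
    (hg : IntervalIntegrable g volume 0 T)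
    (hu : ∀ t ∈ Set.Icc 0 T, u t = c + ∫ s in (0 : ℝ)..t, g s) : CaratheodoryOn u g T := by
  have hac := hg.absolutelyContinuousOnInterval_intervalIntegral (c := 0) (by simp)
  constructor
  · have hconst : AbsolutelyContinuousOnInterval (fun _ : ℝ => c) 0 T :=
      (LipschitzWith.const c).lipschitzOnWith.absolutelyContinuousOnInterval
    refine Filter.Tendsto.congr' ?_ (hconst.add hac)
    filter_upwards [Filter.mem_inf_of_right (Filter.mem_principal_self _)] with E hE
    refine Finset.sum_congr rfl fun i hi => ?_
    have := hE.1 i hi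
    rw [Set.uIcc_of_le hT] at this
    simp only [Pi.add_apply]
    rw [hu _ this.1, hu _ this.2]
  · filter_upwards [hg.ae_hasDerivAt_integral] with t ht hmem
    have hIcc : t ∈ Set.uIcc 0 T := by
      rw [Set.uIcc_of_le hT]; exact Set.Ioo_subset_Icc_self hmem
    refine ((ht hIcc 0 (by simp)).const_add c).congr_of_eventuallyEq ?_
    filter_upwards [Ioo_mem_nhds hmem.1 hmem.2] with s hs
    exact hu s (Set.Ioo_subset_Icc_self hs)

lemma CaratheodoryOn.eq_add_integral {u g : ℝ → ℝ} {T : ℝ} (hT : 0 ≤ T)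
    (h : CaratheodoryOn u g T) : u T = u 0 + ∫ s in (0 : ℝ)..T, g s := by
  have h1 := h.1.integral_deriv_eq_sub
  have h2 : ∫ s in (0 : ℝ)..T, deriv u s = ∫ s in (0 : ℝ)..T, g s := by
    rw [intervalIntegral.integral_of_le hT, intervalIntegral.integral_of_le hT,
      integral_Ioc_eq_integral_Ioo, integral_Ioc_eq_integral_Ioo]
    refine setIntegral_congr_ae measurableSet_Ioo ?_
    filter_upwards [h.2] with s hs hmem using (hs hmem).deriv
  linarith

lemma measurable_intervalIntegral {α : Type*} [MeasurableSpace α] {F : α → ℝ → ℝ} {a b : α → ℝ}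
    (hF : Measurable fun q : α × ℝ => F q.1 q.2) (ha : Measurable a) (hb : Measurable b) :
    Measurable fun p => ∫ s in a p..b p, F p s := by
  have key : ∀ {a b : α → ℝ}, Measurable a → Measurable b →
      Measurable fun p => ∫ s in Set.Ioc (a p) (b p), F p s := by
    intro a b ha hb
    have hS : MeasurableSet {q : α × ℝ | a q.1 < q.2 ∧ q.2 ≤ b q.1} :=
      (measurableSet_lt (ha.comp measurable_fst) measurable_snd).inter
        (measurableSet_le measurable_snd (hb.comp measurable_fst))
    have h := ((hF.indicator hS).stronglyMeasurable.integral_prod_right'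
      (ν := (volume : Measure ℝ))).measurable
    convert! h using 2 with p
    rw [← integral_indicator measurableSet_Ioc]
    rfl
  exact (key ha hb).sub (key hb ha)

/-- A source of size `e ^ (M x)` yields, after integration along a path on which `x` grows with
speed `l`, a function smaller by the factor `1 / (M l)`. -/
lemma abs_integral_le_exp {g : ℝ → ℝ} {M l C x τ : ℝ} (hM : 0 < M) (hl : 0 < l) (hC : 0 ≤ C)
    (hτ : 0 ≤ τ) (hg : ∀ s ∈ Set.Icc 0 τ, |g s| ≤ C * Real.exp (M * (x - l * s))) :
    |∫ s in (0 : ℝ)..τ, g s| ≤ C * Real.exp (M * x) / (M * l) := by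
  have hMl : M * l ≠ 0 := by positivity
  have hderiv : ∀ s ∈ Set.uIcc 0 τ, HasDerivAt
      (fun s => -(C * Real.exp (M * (x - l * s)) / (M * l)))
      (C * Real.exp (M * (x - l * s))) s := by
    intro s _
    have h1 : HasDerivAt (fun s : ℝ => M * (x - l * s)) (M * -(l * 1)) s :=
      (((hasDerivAt_id s).const_mul l).const_sub x).const_mul M
    have h2 := ((h1.exp.const_mul C).div_const (M * l)).neg
    convert! h2 using 1
    field_simp
  have hint := intervalIntegral.integral_eq_sub_of_hasDerivAt hderiv
    (Continuous.intervalIntegrable (by fun_prop) _ _)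
  have hle : |∫ s in (0 : ℝ)..τ, g s| ≤ ∫ s in (0 : ℝ)..τ, C * Real.exp (M * (x - l * s)) := by
    have := intervalIntegral.norm_integral_le_of_norm_le (μ := volume) (f := g) hτ
      (g := fun s => C * Real.exp (M * (x - l * s)))
      (Filter.Eventually.of_forall fun s hs => hg s (Set.Ioc_subset_Icc_self hs))
      (Continuous.intervalIntegrable (by fun_prop) _ _)
    simpa using this
  rw [hint] at hle
  have : 0 ≤ C * Real.exp (M * (x - l * τ)) / (M * l) := by positivity
  simp only [mul_zero, sub_zero] at hle
  linarith

/-! ### The three kernels and their characteristics -/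

/-- Labels of the three unknown matrix functions. -/
inductive KernelKind
  | K
  | L
  | Phi

/-- A candidate for the triple `(K, L, Φ)`, all three stored as functions of `(x, y)`; the value
of `Φ` at `x` is read off at `(x, 0)`. -/
abbrev KernelFamily : Type := KernelKind → ℝ → ℝ → Mat3

namespace KernelKind

/-- The set on which a kernel is determined: the triangle for `K` and `L`, its bottom edge for
`Φ`. -/
def dom : KernelKind → Set (ℝ × ℝ)
  | K => Tri
  | L => Tri
  | Phi => {p | p ∈ Tri ∧ p.2 = 0}

lemma dom_subset_tri (k : KernelKind) : k.dom ⊆ Tri := by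
  cases k
  · exact subset_rfl
  · exact subset_rfl
  · exact fun p hp => hp.1

instance : Finite KernelKind :=
  Finite.of_surjective ![K, L, Phi] fun k => by
    cases k
    · exact ⟨0, rfl⟩
    · exact ⟨1, rfl⟩
    · exact ⟨2, rfl⟩

/-- The kernel which the equation for a given kernel multiplies by its first coefficient matrix. -/
def lead : KernelKind → KernelKind
  | K => K
  | L => K
  | Phi => Phi

lemma dom_lead (k : KernelKind) : k.lead.dom = k.dom := by cases k <;> rfl

lemma isClosed_tri : IsClosed Tri :=
  (isClosed_le continuous_const continuous_snd).inter
    ((isClosed_le continuous_snd continuous_fst).inter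
      (isClosed_le continuous_fst continuous_const))

lemma measurableSet_dom (k : KernelKind) : MeasurableSet k.dom := by
  cases k
  · exact isClosed_tri.measurableSet
  · exact isClosed_tri.measurableSet
  · exact (isClosed_tri.inter (isClosed_eq continuous_snd continuous_const)).measurableSet

end KernelKind

lemma mem_tri {x y : ℝ} : (x, y) ∈ Tri ↔ 0 ≤ y ∧ y ≤ x ∧ x ≤ 1 := Iff.rfl

lemma mem_dom_phi {x y : ℝ} : (x, y) ∈ KernelKind.Phi.dom ↔ (0 ≤ x ∧ x ≤ 1) ∧ y = 0 := by
  simp only [KernelKind.dom, Set.mem_ofPred_eq, mem_tri]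
  constructor
  · rintro ⟨⟨h1, h2, h3⟩, h4⟩
    exact ⟨⟨by linarith, h3⟩, h4⟩
  · rintro ⟨⟨h1, h2⟩, rfl⟩
    exact ⟨⟨le_rfl, h1, h2⟩, rfl⟩

namespace PlateParams

/-- The second component of the characteristic velocity of column `j`; the first component of row
`i` is `λ_i` for all three kernels. -/
noncomputable def vel (P : PlateParams) (k : KernelKind) (j : Fin 3) : ℝ :=
  match k with
  | .K => P.lam j
  | .L => -P.lam j
  | .Phi => 0

/-- The characteristic of the entry `(i, j)` of `K` that ends at `(x, y)` starts on the diagonal,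
and not on the bottom edge. The characteristic issuing from the corner belongs to this case. -/
def FromDiag (P : PlateParams) (i j : Fin 3) (x y : ℝ) : Prop :=
  j < i ∧ P.lam j * x ≤ P.lam i * y

open Classical in
/-- The time which a backward characteristic from `(x, y)` takes to reach the part of the boundary
on which the entry `(i, j)` of the kernel is prescribed. -/
noncomputable def exitTime (P : PlateParams) (k : KernelKind) (i j : Fin 3) (x y : ℝ) : ℝ :=
  match k with
  | .K => if P.FromDiag i j x y then (x - y) / (P.lam i - P.lam j) else y / P.lam j
  | .L => (x - y) / (P.lam i + P.lam j)
  | .Phi => x / P.lam i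

variable {P : PlateParams}

lemma exitTime_K_of_fromDiag {i j : Fin 3} {x y : ℝ} (h : P.FromDiag i j x y) :
    P.exitTime .K i j x y = (x - y) / (P.lam i - P.lam j) := if_pos h

lemma exitTime_K_of_not_fromDiag {i j : Fin 3} {x y : ℝ} (h : ¬P.FromDiag i j x y) :
    P.exitTime .K i j x y = y / P.lam j := if_neg h

lemma exitTime_nonneg (hpos : ∀ i, 0 < P.lam i) (hmono : StrictMono P.lam) {k : KernelKind}
    {x y : ℝ} (h : (x, y) ∈ k.dom) (i j : Fin 3) : 0 ≤ P.exitTime k i j x y := by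
  have hi := hpos i
  have hj := hpos j
  obtain ⟨h1, h2, h3⟩ := mem_tri.1 (k.dom_subset_tri h)
  cases k
  · simp only [exitTime]
    split_ifs with hd
    · have := hmono hd.1
      exact div_nonneg (by linarith) (by linarith)
    · exact div_nonneg h1 hj.le
  · exact div_nonneg (by linarith) (by linarith)
  · exact div_nonneg (by linarith) hi.le

/-- Backward characteristics stay in the domain until the exit time. -/
lemma path_mem_dom (hpos : ∀ i, 0 < P.lam i) (hmono : StrictMono P.lam) {k : KernelKind}
    {x y s : ℝ} (h : (x, y) ∈ k.dom) (i j : Fin 3) (hs : s ∈ Set.Icc 0 (P.exitTime k i j x y)) :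
    (x - P.lam i * s, y - P.vel k j * s) ∈ k.dom := by
  have hi := hpos i
  have hj := hpos j
  obtain ⟨h1, h2, h3⟩ := mem_tri.1 (k.dom_subset_tri h)
  obtain ⟨hs0, hs1⟩ := hs
  have his : 0 ≤ P.lam i * s := by positivity
  have hjs : 0 ≤ P.lam j * s := by positivity
  cases k
  · simp only [exitTime] at hs1
    simp only [KernelKind.dom, vel, mem_tri]
    split_ifs at hs1 with hd
    · have hij := sub_pos.2 (hmono hd.1)
      have hd2 := hd.2
      rw [le_div_iff₀ hij] at hs1
      refine ⟨?_, by linarith, by linarith⟩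
      have h4 : (P.lam i - P.lam j) * (P.lam j * s) ≤ (P.lam i - P.lam j) * y := by
        nlinarith
      linarith [le_of_mul_le_mul_left h4 hij]
    · rw [le_div_iff₀ hj] at hs1
      refine ⟨by linarith, ?_, by linarith⟩
      rcases le_or_gt i j with hij | hij
      · have := mul_le_mul_of_nonneg_right (hmono.monotone hij) hs0
        linarith
      · have hd2 : P.lam i * y < P.lam j * x := by
          by_contra hcon
          exact hd ⟨hij, not_lt.1 hcon⟩
        have hij' := sub_pos.2 (hmono hij)
        have h4 : P.lam j * ((P.lam i - P.lam j) * s) ≤ P.lam j * (x - y) := by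
          nlinarith
        linarith [le_of_mul_le_mul_left h4 hj]
  · simp only [exitTime] at hs1
    simp only [KernelKind.dom, vel, mem_tri]
    rw [le_div_iff₀ (by linarith)] at hs1
    exact ⟨by linarith, by linarith, by linarith⟩
  · simp only [exitTime] at hs1
    rw [le_div_iff₀ hi] at hs1
    have := (mem_dom_phi.1 h).2
    simp only [vel, mem_dom_phi]
    exact ⟨⟨by linarith, by linarith⟩, by linarith⟩

lemma fromDiag_shift {i j : Fin 3} {x y t : ℝ} :
    P.FromDiag i j (x + P.lam i * t) (y + P.lam j * t) ↔ P.FromDiag i j x y := by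
  unfold FromDiag
  refine and_congr_right fun _ => ?_
  constructor <;> intro h <;> linarith

lemma exitTime_shift (hpos : ∀ i, 0 < P.lam i) (hmono : StrictMono P.lam) (k : KernelKind)
    (i j : Fin 3) (x y t : ℝ) :
    P.exitTime k i j (x + P.lam i * t) (y + P.vel k j * t) = P.exitTime k i j x y + t := by
  have hi := hpos i
  have hj := hpos j
  cases k
  · change P.exitTime .K i j (x + P.lam i * t) (y + P.lam j * t) = _
    by_cases hd : P.FromDiag i j x y
    · have hij := sub_pos.2 (hmono hd.1)
      rw [exitTime_K_of_fromDiag (fromDiag_shift.2 hd), exitTime_K_of_fromDiag hd]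
      field_simp
      ring
    · rw [exitTime_K_of_not_fromDiag (mt fromDiag_shift.1 hd), exitTime_K_of_not_fromDiag hd]
      field_simp
  · have : 0 < P.lam i + P.lam j := by linarith
    simp only [exitTime, vel]
    field_simp
    ring
  · simp only [exitTime]
    field_simp

lemma measurableSet_fromDiag (i j : Fin 3) :
    MeasurableSet {p : ℝ × ℝ | P.FromDiag i j p.1 p.2} := by
  by_cases hij : j < i
  · simp only [FromDiag, hij, true_and]
    exact measurableSet_le (by fun_prop) (by fun_prop)
  · simp [FromDiag, hij]

lemma measurable_exitTime (k : KernelKind) (i j : Fin 3) :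
    Measurable fun p : ℝ × ℝ => P.exitTime k i j p.1 p.2 := by
  cases k
  · simp only [exitTime]
    exact Measurable.ite (measurableSet_fromDiag i j) (by fun_prop) (by fun_prop)
  · simp only [exitTime]
    fun_prop
  · simp only [exitTime]
    fun_prop

end PlateParams

/-! ### The right-hand sides -/

namespace PlateParams

variable {P : PlateParams} {n : ℕ}

/-- The coefficient by which the right-hand side multiplies `K` (for the equation of `Φ`:
multiplies `Φ`). -/
noncomputable def coeffLead (P : PlateParams) (n : ℕ) (k : KernelKind) (y : ℝ) : Mat3 :=
  match k with
  | .K => P.F11 n y + P.F12 y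
  | .L => P.F11 n y - P.F12 y
  | .Phi => P.A n

/-- The coefficient by which the right-hand side multiplies `L`. -/
noncomputable def coeffL (P : PlateParams) (n : ℕ) (k : KernelKind) (y : ℝ) : Mat3 :=
  match k with
  | .K => P.F21 n y + P.F22 y
  | .L => P.F21 n y - P.F22 y
  | .Phi => P.Sig * P.D n

/-- The free term of the equation, which is also the integral weight of `K`. -/
noncomputable def weightK (P : PlateParams) (n : ℕ) (k : KernelKind) (x y : ℝ) : Mat3 :=
  match k with
  | .K => P.F14 n x y
  | .L => P.F15 n x y
  | .Phi => P.F13 n x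

/-- The integral weight of `L`. -/
noncomputable def weightL (P : PlateParams) (n : ℕ) (k : KernelKind) (x y : ℝ) : Mat3 :=
  match k with
  | .K => P.F24 n x y
  | .L => P.F25 n x y
  | .Phi => P.F23 n x

/-- The common form of the three right-hand sides (the one of `Φ` is multiplied by `Σ` and is to be
taken at `y = 0`). The quadratic term `Ω K` is split: `Ω` is built from `w`, whereas the factor on
its right is taken from a second family `w'`, so that the expression is affine in `w`. -/
noncomputable def rhs (P : PlateParams) (n : ℕ) (k : KernelKind) (w w' : KernelFamily)
    (x y : ℝ) : Mat3 :=
  w k.lead x y * P.coeffLead n k y + w .L x y * P.coeffL n k y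
    - P.Om n (w .K) x * w' k x y - P.weightK n k x y
    + Matrix.of fun i j =>
        ∫ s in y..x, (w .K x s * P.weightK n k s y + w .L x s * P.weightL n k s y) i j

lemma Om_apply (K : ℝ → ℝ → Mat3) (x : ℝ) (i j : Fin 3) :
    P.Om n K x i j =
      (if i < j then (P.lam i - P.lam j) * K x x i j else 0) + P.Om n 0 x i j := by
  fin_cases i <;> fin_cases j <;> simp [Om, lam]
  ring

lemma Om_apply_of_le (K : ℝ → ℝ → Mat3) (x : ℝ) {i j : Fin 3} (h : j ≤ i) :
    P.Om n K x i j = 0 := by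
  revert h
  fin_cases i <;> fin_cases j <;> simp [Om]

lemma continuous_Om_zero (i j : Fin 3) : Continuous fun x => P.Om n 0 x i j := by
  unfold Om c₂
  fin_cases i <;> fin_cases j <;> simp <;> fun_prop

lemma continuous_F11 (i j : Fin 3) : Continuous fun x => P.F11 n x i j := by
  unfold F11 c₁ c₂ c₅ c₆
  fin_cases i <;> fin_cases j <;> simp <;> fun_prop

lemma continuous_F12 (i j : Fin 3) : Continuous fun x => P.F12 x i j := by
  unfold F12 c₁ c₅ c₆
  fin_cases i <;> fin_cases j <;> simp <;> fun_prop

lemma continuous_F21 (i j : Fin 3) : Continuous fun x => P.F21 n x i j := by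
  unfold F21 c₃ c₄ c₅ c₆
  fin_cases i <;> fin_cases j <;> simp <;> fun_prop

lemma continuous_F22 (i j : Fin 3) : Continuous fun x => P.F22 x i j := by
  unfold F22 c₃ c₅ c₆
  fin_cases i <;> fin_cases j <;> simp <;> fun_prop

lemma continuous_F13 (i j : Fin 3) : Continuous fun x => P.F13 n x i j := by
  unfold F13 c₂
  fin_cases i <;> fin_cases j <;> simp <;> fun_prop

lemma continuous_F23 (i j : Fin 3) : Continuous fun x => P.F23 n x i j := by
  unfold F23 c₄
  fin_cases i <;> fin_cases j <;> simp <;> fun_prop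

lemma continuous_F14 (i j : Fin 3) : Continuous fun p : ℝ × ℝ => P.F14 n p.1 p.2 i j := by
  unfold F14 c₂ c₅ f₁₁
  fin_cases i <;> fin_cases j <;> simp <;> fun_prop

lemma continuous_F15 (i j : Fin 3) : Continuous fun p : ℝ × ℝ => P.F15 n p.1 p.2 i j := by
  unfold F15 c₂ c₆ f₁₂
  fin_cases i <;> fin_cases j <;> simp <;> fun_prop

lemma continuous_F24 (i j : Fin 3) : Continuous fun p : ℝ × ℝ => P.F24 n p.1 p.2 i j := by
  unfold F24 c₄ c₅ f₂₁
  fin_cases i <;> fin_cases j <;> simp <;> fun_prop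

lemma continuous_F25 (i j : Fin 3) : Continuous fun p : ℝ × ℝ => P.F25 n p.1 p.2 i j := by
  unfold F25 c₄ c₆ f₂₂
  fin_cases i <;> fin_cases j <;> simp <;> fun_prop

lemma continuous_coeffLead (k : KernelKind) (i j : Fin 3) :
    Continuous fun y => P.coeffLead n k y i j := by
  cases k
  · exact (continuous_F11 i j).add (continuous_F12 i j)
  · exact (continuous_F11 i j).sub (continuous_F12 i j)
  · exact continuous_const

lemma continuous_coeffL (k : KernelKind) (i j : Fin 3) :
    Continuous fun y => P.coeffL n k y i j := by
  cases k
  · exact (continuous_F21 i j).add (continuous_F22 i j)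
  · exact (continuous_F21 i j).sub (continuous_F22 i j)
  · exact continuous_const

lemma continuous_weightK (k : KernelKind) (i j : Fin 3) :
    Continuous fun p : ℝ × ℝ => P.weightK n k p.1 p.2 i j := by
  cases k
  · exact continuous_F14 i j
  · exact continuous_F15 i j
  · exact (continuous_F13 i j).comp continuous_fst

lemma continuous_weightL (k : KernelKind) (i j : Fin 3) :
    Continuous fun p : ℝ × ℝ => P.weightL n k p.1 p.2 i j := by
  cases k
  · exact continuous_F24 i j
  · exact continuous_F25 i j
  · exact (continuous_F23 i j).comp continuous_fst

lemma isCompact_tri : IsCompact Tri := by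
  refine Metric.isCompact_of_isClosed_isBounded KernelKind.isClosed_tri ?_
  refine (Metric.isBounded_Icc (0 : ℝ × ℝ) 1).subset fun p hp => ?_
  obtain ⟨h1, h2, h3⟩ := hp
  exact ⟨⟨by simp only [Prod.fst_zero]; linarith, h1⟩, ⟨h3, by simp only [Prod.snd_one]; linarith⟩⟩

lemma exists_bound_of_continuous {ι : Type*} [Finite ι] {G : ι → ℝ × ℝ → ℝ}
    (hG : ∀ a, Continuous (G a)) : ∃ B, ∀ a, ∀ p ∈ Tri, |G a p| ≤ B := by
  choose b hb using fun a => isCompact_tri.exists_bound_of_continuousOn (hG a).continuousOn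
  obtain ⟨B, hB⟩ := (Set.finite_range b).bddAbove
  exact ⟨B, fun a p hp => (hb a p hp).trans (hB ⟨a, rfl⟩)⟩

variable (P n) in
/-- A common bound of all the data of the equations. -/
lemma exists_coeff_bound : ∃ B : ℝ, 0 < B ∧ ∀ (k : KernelKind) (i j : Fin 3) (x y : ℝ),
    (x, y) ∈ Tri → |P.coeffLead n k y i j| ≤ B ∧ |P.coeffL n k y i j| ≤ B ∧
      |P.weightK n k x y i j| ≤ B ∧ |P.weightL n k x y i j| ≤ B ∧ |P.Om n 0 x i j| ≤ B ∧
      |P.lam i - P.lam j| ≤ B := by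
  obtain ⟨B1, h1⟩ := exists_bound_of_continuous
    (G := fun (a : KernelKind × Fin 3 × Fin 3) p => P.coeffLead n a.1 p.2 a.2.1 a.2.2)
    fun a => (continuous_coeffLead a.1 a.2.1 a.2.2).comp continuous_snd
  obtain ⟨B2, h2⟩ := exists_bound_of_continuous
    (G := fun (a : KernelKind × Fin 3 × Fin 3) p => P.coeffL n a.1 p.2 a.2.1 a.2.2)
    fun a => (continuous_coeffL a.1 a.2.1 a.2.2).comp continuous_snd
  obtain ⟨B3, h3⟩ := exists_bound_of_continuous
    (G := fun (a : KernelKind × Fin 3 × Fin 3) p => P.weightK n a.1 p.1 p.2 a.2.1 a.2.2)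
    fun a => continuous_weightK a.1 a.2.1 a.2.2
  obtain ⟨B4, h4⟩ := exists_bound_of_continuous
    (G := fun (a : KernelKind × Fin 3 × Fin 3) p => P.weightL n a.1 p.1 p.2 a.2.1 a.2.2)
    fun a => continuous_weightL a.1 a.2.1 a.2.2
  obtain ⟨B5, h5⟩ := exists_bound_of_continuous
    (G := fun (a : Fin 3 × Fin 3) p => P.Om n 0 p.1 a.1 a.2)
    fun a => (continuous_Om_zero a.1 a.2).comp continuous_fst
  obtain ⟨B6, h6⟩ := exists_bound_of_continuous
    (G := fun (a : Fin 3 × Fin 3) (_ : ℝ × ℝ) => P.lam a.1 - P.lam a.2)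
    fun a => continuous_const
  refine ⟨|B1| + |B2| + |B3| + |B4| + |B5| + |B6| + 1, by positivity, fun k i j x y hp => ?_⟩
  have g1 := h1 (k, i, j) _ hp
  have g2 := h2 (k, i, j) _ hp
  have g3 := h3 (k, i, j) _ hp
  have g4 := h4 (k, i, j) _ hp
  have g5 := h5 (i, j) _ hp
  have g6 := h6 (i, j) _ hp
  simp only at g1 g2 g3 g4 g5 g6
  have a1 := le_abs_self B1
  have a2 := le_abs_self B2
  have a3 := le_abs_self B3
  have a4 := le_abs_self B4
  have a5 := le_abs_self B5
  have a6 := le_abs_self B6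
  have b1 := abs_nonneg B1
  have b2 := abs_nonneg B2
  have b3 := abs_nonneg B3
  have b4 := abs_nonneg B4
  have b5 := abs_nonneg B5
  have b6 := abs_nonneg B6
  refine ⟨?_, ?_, ?_, ?_, ?_, ?_⟩ <;> linarith

end PlateParams

/-! ### The Lipschitz estimate, row by row -/

/-- The families among which solutions are sought: measurable on the plane, bounded where the
kernels are determined. -/
structure KernelFamily.Admissible (w : KernelFamily) : Prop where
  measurable : ∀ k i j, Measurable fun p : ℝ × ℝ => w k p.1 p.2 i j
  bounded : ∃ B : ℝ, 0 ≤ B ∧ ∀ k x y, (x, y) ∈ k.dom → ∀ i j, |w k x y i j| ≤ B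

/-- Row `i` of the two families differs by at most `δ x` at abscissa `x`. -/
def KernelFamily.CloseOnRow (i : Fin 3) (δ : ℝ → ℝ) (w v : KernelFamily) : Prop :=
  ∀ (k : KernelKind) (x y : ℝ), (x, y) ∈ k.dom → ∀ j, |w k x y i j - v k x y i j| ≤ δ x

lemma KernelFamily.CloseOnRow.triangle {i : Fin 3} {δ δ' : ℝ → ℝ} {w v u : KernelFamily}
    (h : CloseOnRow i δ w v) (h' : CloseOnRow i δ' v u) :
    CloseOnRow i (fun x => δ x + δ' x) w u := fun k x y hp j =>
  (abs_sub_le _ _ _).trans (add_le_add (h k x y hp j) (h' k x y hp j))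

lemma KernelFamily.CloseOnRow.symm {i : Fin 3} {δ : ℝ → ℝ} {w v : KernelFamily}
    (h : CloseOnRow i δ w v) : CloseOnRow i δ v w := fun k x y hp j => by
  rw [abs_sub_comm]; exact h k x y hp j

lemma KernelFamily.CloseOnRow.mono {i : Fin 3} {δ δ' : ℝ → ℝ} {w v : KernelFamily}
    (h : CloseOnRow i δ w v) (hle : ∀ x, δ x ≤ δ' x) : CloseOnRow i δ' w v :=
  fun k x y hp j => (h k x y hp j).trans (hle x)

lemma KernelFamily.admissible_zero : KernelFamily.Admissible 0 where
  measurable _ _ _ := measurable_const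
  bounded := ⟨0, le_rfl, by simp⟩

lemma abs_mul_apply_le {X Y : Mat3} {i j : Fin 3} {a b : ℝ} (hX : ∀ m, |X i m| ≤ a)
    (hY : ∀ m, |Y m j| ≤ b) : |(X * Y) i j| ≤ 3 * (a * b) := by
  have ha : 0 ≤ a := (abs_nonneg _).trans (hX 0)
  rw [Matrix.mul_apply]
  refine (Finset.abs_sum_le_sum_abs _ _).trans ?_
  refine (Finset.sum_le_card_nsmul _ _ (a * b) fun m _ => ?_).trans (by simp)
  rw [abs_mul]
  exact mul_le_mul (hX m) (hY m) (abs_nonneg _) ha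

lemma measurable_mul_apply {α : Type*} [MeasurableSpace α] {X Y : α → Mat3} {i j : Fin 3}
    (hX : ∀ m, Measurable fun a => X a i m) (hY : ∀ m, Measurable fun a => Y a m j) :
    Measurable fun a => (X a * Y a) i j := by
  simp only [Matrix.mul_apply]
  exact Finset.measurable_sum _ fun m _ => (hX m).mul (hY m)

namespace PlateParams

open KernelFamily

variable {P : PlateParams} {n : ℕ}

lemma measurable_integrand {w : KernelFamily} (hw : w.Admissible) (k : KernelKind)
    (i j : Fin 3) : Measurable fun q : (ℝ × ℝ) × ℝ =>
      (w .K q.1.1 q.2 * P.weightK n k q.2 q.1.2 +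
        w .L q.1.1 q.2 * P.weightL n k q.2 q.1.2) i j := by
  have h1 : Measurable fun q : (ℝ × ℝ) × ℝ => (q.1.1, q.2) := by fun_prop
  have h2 : Measurable fun q : (ℝ × ℝ) × ℝ => (q.2, q.1.2) := by fun_prop
  have hK (m : Fin 3) : Measurable fun q : (ℝ × ℝ) × ℝ => w .K q.1.1 q.2 i m :=
    (hw.measurable .K i m).comp h1
  have hL (m : Fin 3) : Measurable fun q : (ℝ × ℝ) × ℝ => w .L q.1.1 q.2 i m :=
    (hw.measurable .L i m).comp h1
  have hwK (m : Fin 3) : Measurable fun q : (ℝ × ℝ) × ℝ => P.weightK n k q.2 q.1.2 m j := by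
    simpa only [Function.comp_def] using
      (continuous_weightK (P := P) (n := n) k m j).measurable.comp h2
  have hwL (m : Fin 3) : Measurable fun q : (ℝ × ℝ) × ℝ => P.weightL n k q.2 q.1.2 m j := by
    simpa only [Function.comp_def] using
      (continuous_weightL (P := P) (n := n) k m j).measurable.comp h2
  exact (measurable_mul_apply hK hwK).add (measurable_mul_apply hL hwL)

lemma measurable_rhs {w w' : KernelFamily} (hw : w.Admissible) (hw' : w'.Admissible)
    (k : KernelKind) (i j : Fin 3) :
    Measurable fun p : ℝ × ℝ => P.rhs n k w w' p.1 p.2 i j := by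
  have hOm : ∀ m, Measurable fun p : ℝ × ℝ => P.Om n (w .K) p.1 i m := by
    intro m
    simp only [Om_apply (w .K)]
    refine Measurable.add ?_ ((continuous_Om_zero i m).measurable.comp measurable_fst)
    split_ifs
    · exact ((hw.measurable .K i m).comp (measurable_fst.prodMk measurable_fst)).const_mul _
    · exact measurable_const
  refine Measurable.add (Measurable.sub (Measurable.sub (Measurable.add ?_ ?_) ?_) ?_) ?_
  · exact measurable_mul_apply (fun m => hw.measurable _ i m)
      fun m => (continuous_coeffLead k m j).measurable.comp measurable_snd
  · exact measurable_mul_apply (fun m => hw.measurable _ i m)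
      fun m => (continuous_coeffL k m j).measurable.comp measurable_snd
  · exact measurable_mul_apply hOm fun m => hw'.measurable _ m j
  · exact (continuous_weightK k i j).measurable
  · exact measurable_intervalIntegral (measurable_integrand hw k i j) measurable_snd measurable_fst

lemma mem_tri_of_mem_Icc {x y s : ℝ} (hp : (x, y) ∈ Tri) (hs : s ∈ Set.Icc y x) :
    (x, s) ∈ Tri ∧ (s, y) ∈ Tri := by
  obtain ⟨h1, h2, h3⟩ := hp
  exact ⟨⟨h1.trans hs.1, hs.2, h3⟩, ⟨h1, hs.1, hs.2.trans h3⟩⟩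

lemma intervalIntegrable_integrand {w : KernelFamily} (hw : w.Admissible) (k : KernelKind)
    (i j : Fin 3) {x y : ℝ} (hp : (x, y) ∈ Tri) : IntervalIntegrable
      (fun s => (w .K x s * P.weightK n k s y + w .L x s * P.weightL n k s y) i j) volume y x := by
  obtain ⟨B, -, hB⟩ := exists_coeff_bound P n
  obtain ⟨W, -, hW⟩ := hw.bounded
  have hm := (measurable_integrand (P := P) (n := n) hw k i j).comp
    (measurable_const.prodMk measurable_id : Measurable fun s : ℝ => ((x, y), s))
  refine intervalIntegrable_of_abs_le (B := 3 * (W * B) + 3 * (W * B)) hp.2.1 hm fun s hs => ?_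
  obtain ⟨hs1, hs2⟩ := mem_tri_of_mem_Icc hp hs
  refine (abs_add_le _ _).trans (add_le_add ?_ ?_)
  · exact abs_mul_apply_le (fun m => hW .K x s hs1 i m) fun m => (hB k m j s y hs2).2.2.1
  · exact abs_mul_apply_le (fun m => hW .L x s hs1 i m) fun m => (hB k m j s y hs2).2.2.2.1

variable (P n) in
/-- Row `i` of the right-hand side depends on its affine argument only through row `i`, in a
Lipschitz way, and on the other one only through the rows below `i`, because `Ω` is strictly upper
triangular. -/
lemma exists_rhs_sub_le {W : ℝ} (hW : 0 ≤ W) : ∃ C : ℝ, 0 < C ∧ ∀ (i : Fin 3)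
    (w v w' v' : KernelFamily) (δ : ℝ → ℝ), w.Admissible → v.Admissible →
    (∀ k x y, (x, y) ∈ k.dom → ∀ i j, |w' k x y i j| ≤ W) →
    (∀ m, i < m → CloseOnRow m 0 w' v') → CloseOnRow i δ w v →
    ∀ k x y, (x, y) ∈ k.dom → ∀ j,
      |P.rhs n k w w' x y i j - P.rhs n k v v' x y i j| ≤ C * δ x := by
  obtain ⟨B, hB0, hB⟩ := exists_coeff_bound P n
  refine ⟨12 * B + 3 * (B * W), by positivity, ?_⟩
  intro i w v w' v' δ hw hv hw' hvw' hδ k x y hp j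
  have hT : (x, y) ∈ Tri := k.dom_subset_tri hp
  have hxx : (x, x) ∈ Tri := ⟨hT.1.trans hT.2.1, le_rfl, hT.2.2⟩
  have hδ0 : 0 ≤ δ x := (abs_nonneg _).trans (hδ k x y hp 0)
  have e1 : |((w k.lead x y - v k.lead x y) * P.coeffLead n k y) i j| ≤ 3 * (δ x * B) :=
    abs_mul_apply_le (fun m => hδ k.lead x y (by rwa [k.dom_lead]) m)
      fun m => (hB k m j x y hT).1
  have e2 : |((w .L x y - v .L x y) * P.coeffL n k y) i j| ≤ 3 * (δ x * B) :=
    abs_mul_apply_le (fun m => hδ .L x y hT m) fun m => (hB k m j x y hT).2.1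
  have e3 : |((P.Om n (w .K) x - P.Om n (v .K) x) * w' k x y) i j| ≤ 3 * ((B * δ x) * W) := by
    refine abs_mul_apply_le (fun m => ?_) fun m => hw' k x y hp m j
    rw [Matrix.sub_apply, Om_apply (w .K), Om_apply (v .K), add_sub_add_right_eq_sub]
    split_ifs
    · rw [← mul_sub, abs_mul]
      exact mul_le_mul (hB k i m x y hT).2.2.2.2.2 (hδ .K x x hxx m) (abs_nonneg _) hB0.le
    · rw [sub_zero, abs_zero]; positivity
  have e3' : (P.Om n (v .K) x * w' k x y) i j = (P.Om n (v .K) x * v' k x y) i j := by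
    simp only [Matrix.mul_apply]
    refine Finset.sum_congr rfl fun m _ => ?_
    rcases le_or_gt m i with hm | hm
    · simp [Om_apply_of_le (v .K) x hm]
    · have := hvw' m hm k x y hp j
      rw [Pi.zero_apply, abs_nonpos_iff, sub_eq_zero] at this
      rw [this]
  have e4 : |(∫ s in y..x, (w .K x s * P.weightK n k s y + w .L x s * P.weightL n k s y) i j) -
      ∫ s in y..x, (v .K x s * P.weightK n k s y + v .L x s * P.weightL n k s y) i j| ≤
        6 * (δ x * B) := by
    rw [← intervalIntegral.integral_sub (intervalIntegrable_integrand hw k i j hT)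
      (intervalIntegrable_integrand hv k i j hT)]
    have hle : ∀ s ∈ Set.uIoc y x,
        ‖(w .K x s * P.weightK n k s y + w .L x s * P.weightL n k s y) i j -
          (v .K x s * P.weightK n k s y + v .L x s * P.weightL n k s y) i j‖ ≤ 6 * (δ x * B) := by
      intro s hs
      rw [Set.uIoc_of_le hT.2.1] at hs
      obtain ⟨hs1, hs2⟩ := mem_tri_of_mem_Icc hT (Set.Ioc_subset_Icc_self hs)
      have h1 : |((w .K x s - v .K x s) * P.weightK n k s y) i j| ≤ 3 * (δ x * B) :=
        abs_mul_apply_le (fun m => hδ .K x s hs1 m) fun m => (hB k m j s y hs2).2.2.1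
      have h2 : |((w .L x s - v .L x s) * P.weightL n k s y) i j| ≤ 3 * (δ x * B) :=
        abs_mul_apply_le (fun m => hδ .L x s hs1 m) fun m => (hB k m j s y hs2).2.2.2.1
      rw [Matrix.sub_mul, Matrix.sub_apply] at h1 h2
      rw [Real.norm_eq_abs, Matrix.add_apply, Matrix.add_apply, add_sub_add_comm]
      exact (abs_add_le _ _).trans (by linarith)
    refine (intervalIntegral.norm_integral_le_of_norm_le_const hle).trans ?_
    have hlen : |x - y| ≤ 1 := by
      rw [abs_of_nonneg (by linarith [hT.2.1])]; linarith [hT.1, hT.2.2]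
    exact mul_le_of_le_one_right (by positivity) hlen
  rw [Matrix.sub_mul, Matrix.sub_apply] at e1 e2 e3
  rw [e3'] at e3
  simp only [rhs, Matrix.add_apply, Matrix.sub_apply, Matrix.of_apply] at e4 ⊢
  rw [abs_le] at e1 e2 e3 e4 ⊢
  constructor <;> linarith

/-- The right-hand side of admissible families is bounded. -/
lemma exists_rhs_bound {w w' : KernelFamily} (hw : w.Admissible) (hw' : w'.Admissible) :
    ∃ R : ℝ, 0 ≤ R ∧ ∀ k x y, (x, y) ∈ k.dom → ∀ i j, |P.rhs n k w w' x y i j| ≤ R := by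
  obtain ⟨B, hB0, hB⟩ := exists_coeff_bound P n
  obtain ⟨W, hW0, hW⟩ := hw.bounded
  obtain ⟨W', hW0', hW'⟩ := hw'.bounded
  obtain ⟨C, hC0, hC⟩ := exists_rhs_sub_le P n hW0'
  refine ⟨C * W + (3 * (B * W') + B), by positivity, fun k x y hp i j => ?_⟩
  have hT := k.dom_subset_tri hp
  have h1 := hC i w 0 w' w' (fun _ => W) hw admissible_zero hW'
    (fun m _ k x y _ j => by simp) (fun k x y hp j => by simpa using hW k x y hp i j) k x y hp j
  have h2 : P.rhs n k 0 w' x y i j = -(P.Om n 0 x * w' k x y) i j - P.weightK n k x y i j := by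
    simp [rhs]
  have h3 : |(P.Om n 0 x * w' k x y) i j| ≤ 3 * (B * W') :=
    abs_mul_apply_le (fun m => (hB k i m x y hT).2.2.2.2.1) fun m => hW' k x y hp m j
  have h4 := (hB k i j x y hT).2.2.1
  rw [h2] at h1
  rw [abs_le] at h1 h3 h4 ⊢
  constructor <;> linarith

end PlateParams

/-! ### The integral operator along the characteristics -/

namespace PlateParams

open KernelFamily

variable {P : PlateParams} {n : ℕ} {Φ₀ : Mat3}

/-- The abscissa of the boundary point at which the backward characteristic from `(x, y)` ends. -/
noncomputable def exitX (P : PlateParams) (k : KernelKind) (i j : Fin 3) (x y : ℝ) : ℝ :=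
  x - P.lam i * P.exitTime k i j x y

/-- The integral of the right-hand side along the characteristic that ends at `(x, y)`. -/
noncomputable def transport (P : PlateParams) (n : ℕ) (k : KernelKind) (w w' : KernelFamily)
    (i j : Fin 3) (x y : ℝ) : ℝ :=
  ∫ s in (0 : ℝ)..P.exitTime k i j x y,
    P.rhs n k w w' (x - P.lam i * s) (y - P.vel k j * s) i j

open Classical in
/-- The boundary value from which the characteristic that ends at `(x, y)` starts. On the bottom
edge the entries of `K` are computed from those of `Φ` and `L` in the family `v`. -/
noncomputable def inflow (P : PlateParams) (n : ℕ) (Φ₀ : Mat3) (v : KernelFamily) (k : KernelKind)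
    (i j : Fin 3) (x y : ℝ) : ℝ :=
  match k with
  | .K =>
      if P.FromDiag i j x y then
        -(P.F11 n (P.exitX .K i j x y) + P.F12 (P.exitX .K i j x y)) i j / (P.lam i - P.lam j)
      else v .Phi (P.exitX .K i j x y) 0 i j - v .L (P.exitX .K i j x y) 0 i j
  | .L => -(P.F11 n (P.exitX .L i j x y) - P.F12 (P.exitX .L i j x y)) i j / (P.lam i + P.lam j)
  | .Phi => Φ₀ i j

lemma inflow_K_of_fromDiag {v : KernelFamily} {i j : Fin 3} {x y : ℝ} (h : P.FromDiag i j x y) :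
    P.inflow n Φ₀ v .K i j x y =
      -(P.F11 n (P.exitX .K i j x y) + P.F12 (P.exitX .K i j x y)) i j / (P.lam i - P.lam j) :=
  if_pos h

lemma inflow_K_of_not_fromDiag {v : KernelFamily} {i j : Fin 3} {x y : ℝ}
    (h : ¬P.FromDiag i j x y) : P.inflow n Φ₀ v .K i j x y =
      v .Phi (P.exitX .K i j x y) 0 i j - v .L (P.exitX .K i j x y) 0 i j :=
  if_neg h

/-- Boundary value, with the bottom values of `K` taken from `v`, plus transport. -/
noncomputable def stepWith (P : PlateParams) (n : ℕ) (Φ₀ : Mat3) (v w w' : KernelFamily) :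
    KernelFamily :=
  fun k x y => Matrix.of fun i j => P.inflow n Φ₀ v k i j x y + P.transport n k w w' i j x y

lemma stepWith_apply (v w w' : KernelFamily) (k : KernelKind) (x y : ℝ) (i j : Fin 3) :
    P.stepWith n Φ₀ v w w' k x y i j =
      P.inflow n Φ₀ v k i j x y + P.transport n k w w' i j x y := rfl

/-- The integral operator whose fixed points in `w` are sought. The bottom values of `K` are taken
from the *updated* `Φ` and `L`: with the old ones the operator would not be a contraction. -/
noncomputable def step (P : PlateParams) (n : ℕ) (Φ₀ : Mat3) (w w' : KernelFamily) :
    KernelFamily :=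
  P.stepWith n Φ₀ (P.stepWith n Φ₀ w w w') w w'

lemma exitX_mem (hpos : ∀ i, 0 < P.lam i) (hmono : StrictMono P.lam) {k : KernelKind}
    {x y : ℝ} (h : (x, y) ∈ k.dom) (i j : Fin 3) :
    0 ≤ P.exitX k i j x y ∧ P.exitX k i j x y ≤ x := by
  have hτ := exitTime_nonneg hpos hmono h i j
  obtain ⟨h1, h2, -⟩ := k.dom_subset_tri (path_mem_dom hpos hmono h i j ⟨hτ, le_rfl⟩)
  refine ⟨h1.trans h2, ?_⟩
  have := mul_nonneg (hpos i).le hτ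
  unfold exitX
  linarith

lemma bottom_mem_dom (k : KernelKind) {x : ℝ} (h0 : 0 ≤ x) (h1 : x ≤ 1) : (x, 0) ∈ k.dom := by
  cases k
  · exact ⟨le_rfl, h0, h1⟩
  · exact ⟨le_rfl, h0, h1⟩
  · exact mem_dom_phi.2 ⟨⟨h0, h1⟩, rfl⟩

lemma measurable_rhs_path {w w' : KernelFamily} (hw : w.Admissible) (hw' : w'.Admissible)
    (k : KernelKind) (i j : Fin 3) : Measurable fun q : (ℝ × ℝ) × ℝ =>
      P.rhs n k w w' (q.1.1 - P.lam i * q.2) (q.1.2 - P.vel k j * q.2) i j := by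
  have h : Measurable fun q : (ℝ × ℝ) × ℝ =>
      (q.1.1 - P.lam i * q.2, q.1.2 - P.vel k j * q.2) := by fun_prop
  simpa only [Function.comp_def] using (measurable_rhs (P := P) (n := n) hw hw' k i j).comp h

lemma intervalIntegrable_rhs_path (hpos : ∀ i, 0 < P.lam i) (hmono : StrictMono P.lam)
    {w w' : KernelFamily} (hw : w.Admissible) (hw' : w'.Admissible) {k : KernelKind}
    {x y : ℝ} (h : (x, y) ∈ k.dom) (i j : Fin 3) : IntervalIntegrable
      (fun s => P.rhs n k w w' (x - P.lam i * s) (y - P.vel k j * s) i j) volume 0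
      (P.exitTime k i j x y) := by
  obtain ⟨R, -, hR⟩ := exists_rhs_bound (P := P) (n := n) hw hw'
  have hm := (measurable_rhs_path (P := P) (n := n) hw hw' k i j).comp
    (measurable_const.prodMk measurable_id : Measurable fun s : ℝ => ((x, y), s))
  exact intervalIntegrable_of_abs_le (exitTime_nonneg hpos hmono h i j) hm
    fun s hs => hR k _ _ (path_mem_dom hpos hmono h i j hs) i j

lemma measurable_exitX (k : KernelKind) (i j : Fin 3) :
    Measurable fun p : ℝ × ℝ => P.exitX k i j p.1 p.2 :=
  measurable_fst.sub ((measurable_exitTime k i j).const_mul _)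

lemma measurable_inflow {v : KernelFamily} (hv : v.Admissible) (k : KernelKind) (i j : Fin 3) :
    Measurable fun p : ℝ × ℝ => P.inflow n Φ₀ v k i j p.1 p.2 := by
  have hX := measurable_exitX (P := P) k i j
  have hX0 : Measurable fun p : ℝ × ℝ => (P.exitX k i j p.1 p.2, (0 : ℝ)) :=
    hX.prodMk measurable_const
  cases k
  · refine Measurable.ite (measurableSet_fromDiag i j) ?_ ?_
    · exact ((((continuous_F11 i j).add (continuous_F12 i j)).neg.measurable).comp hX).div_const _
    · exact ((hv.measurable .Phi i j).comp hX0).sub ((hv.measurable .L i j).comp hX0)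
  · exact ((((continuous_F11 i j).sub (continuous_F12 i j)).neg.measurable).comp hX).div_const _
  · exact measurable_const

lemma exists_inflow_bound (hpos : ∀ i, 0 < P.lam i) (hmono : StrictMono P.lam)
    {v : KernelFamily} (hv : v.Admissible) : ∃ R : ℝ, ∀ k x y, (x, y) ∈ k.dom → ∀ i j,
      |P.inflow n Φ₀ v k i j x y| ≤ R := by
  obtain ⟨V, hV0, hV⟩ := hv.bounded
  obtain ⟨B1, h1⟩ := exists_bound_of_continuous
    (G := fun (a : Fin 3 × Fin 3) p =>
      -(P.F11 n p.1 + P.F12 p.1) a.1 a.2 / (P.lam a.1 - P.lam a.2))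
    fun a => ((((continuous_F11 a.1 a.2).add (continuous_F12 a.1 a.2)).neg).comp
      continuous_fst).div_const _
  obtain ⟨B2, h2⟩ := exists_bound_of_continuous
    (G := fun (a : Fin 3 × Fin 3) p =>
      -(P.F11 n p.1 - P.F12 p.1) a.1 a.2 / (P.lam a.1 + P.lam a.2))
    fun a => ((((continuous_F11 a.1 a.2).sub (continuous_F12 a.1 a.2)).neg).comp
      continuous_fst).div_const _
  obtain ⟨B3, h3⟩ := exists_bound_of_continuous
    (G := fun (a : Fin 3 × Fin 3) (_ : ℝ × ℝ) => Φ₀ a.1 a.2) fun a => continuous_const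
  refine ⟨|B1| + |B2| + |B3| + (V + V), fun k x y hp i j => ?_⟩
  have a1 := le_abs_self B1
  have a2 := le_abs_self B2
  have a3 := le_abs_self B3
  have b1 := abs_nonneg B1
  have b2 := abs_nonneg B2
  have b3 := abs_nonneg B3
  obtain ⟨hX0, hX1⟩ := exitX_mem hpos hmono hp i j
  have hX2 := hX1.trans (k.dom_subset_tri hp).2.2
  have hz : (P.exitX k i j x y, (0 : ℝ)) ∈ Tri := ⟨le_rfl, hX0, hX2⟩
  cases k
  · by_cases hd : P.FromDiag i j x y
    · rw [inflow_K_of_fromDiag hd]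
      exact (h1 (i, j) _ hz).trans (by linarith)
    · rw [inflow_K_of_not_fromDiag hd]
      have g1 := hV .Phi _ _ (bottom_mem_dom .Phi hX0 hX2) i j
      have g2 := hV .L _ _ (bottom_mem_dom .L hX0 hX2) i j
      exact (abs_sub _ _).trans (by linarith)
  · exact (h2 (i, j) _ hz).trans (by linarith)
  · exact (h3 (i, j) _ hz).trans (by linarith)

lemma exists_transport_bound (hpos : ∀ i, 0 < P.lam i) (hmono : StrictMono P.lam)
    {w w' : KernelFamily} (hw : w.Admissible) (hw' : w'.Admissible) :
    ∃ R : ℝ, ∀ k x y, (x, y) ∈ k.dom → ∀ i j, |P.transport n k w w' i j x y| ≤ R := by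
  obtain ⟨R, hR0, hR⟩ := exists_rhs_bound (P := P) (n := n) hw hw'
  refine ⟨R * Real.exp 1 / P.lam 0, fun k x y hp i j => ?_⟩
  have h0 := hpos 0
  have hT := k.dom_subset_tri hp
  have h := abs_integral_le_exp (M := 1) (x := x) (C := R) one_pos (hpos i) hR0
    (exitTime_nonneg hpos hmono hp i j)
    (g := fun s => P.rhs n k w w' (x - P.lam i * s) (y - P.vel k j * s) i j) fun s hs => by
      have hq := path_mem_dom hpos hmono hp i j hs
      refine (hR k _ _ hq i j).trans (le_mul_of_one_le_right hR0 (Real.one_le_exp ?_))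
      obtain ⟨h1, h2, -⟩ := k.dom_subset_tri hq
      rw [one_mul]
      exact h1.trans h2
  refine h.trans ?_
  rw [one_mul, one_mul]
  have := hmono.monotone (Fin.zero_le i)
  have := hT.2.2
  gcongr

lemma admissible_stepWith (hpos : ∀ i, 0 < P.lam i) (hmono : StrictMono P.lam)
    {v w w' : KernelFamily} (hv : v.Admissible) (hw : w.Admissible) (hw' : w'.Admissible) :
    (P.stepWith n Φ₀ v w w').Admissible where
  measurable k i j := (measurable_inflow hv k i j).add
    (measurable_intervalIntegral (measurable_rhs_path hw hw' k i j) measurable_const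
      (measurable_exitTime k i j))
  bounded := by
    obtain ⟨R1, h1⟩ := exists_inflow_bound (n := n) (Φ₀ := Φ₀) hpos hmono hv
    obtain ⟨R2, h2⟩ := exists_transport_bound (n := n) hpos hmono hw hw'
    refine ⟨|R1 + R2|, abs_nonneg _, fun k x y hp i j => ?_⟩
    exact ((abs_add_le _ _).trans (add_le_add (h1 k x y hp i j) (h2 k x y hp i j))).trans
      (le_abs_self _)

lemma admissible_step (hpos : ∀ i, 0 < P.lam i) (hmono : StrictMono P.lam)
    {w w' : KernelFamily} (hw : w.Admissible) (hw' : w'.Admissible) :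
    (P.step n Φ₀ w w').Admissible :=
  admissible_stepWith hpos hmono (admissible_stepWith hpos hmono hw hw hw') hw hw'

/-- In the norm with weight `e ^ (-M x)`, `M` large, the integral operator is a contraction on each
row, uniformly for `w'` in a bounded set. -/
lemma exists_step_contraction (n : ℕ) (Φ₀ : Mat3) (hpos : ∀ i, 0 < P.lam i)
    (hmono : StrictMono P.lam) {W : ℝ} (hW : 0 ≤ W) : ∃ M : ℝ, 0 < M ∧ ∀ (i : Fin 3)
    (w v w' v' : KernelFamily) (c : ℝ), w.Admissible → v.Admissible → w'.Admissible →
    v'.Admissible → (∀ k x y, (x, y) ∈ k.dom → ∀ i j, |w' k x y i j| ≤ W) →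
    (∀ m, i < m → CloseOnRow m 0 w' v') → 0 ≤ c →
    CloseOnRow i (fun x => c * Real.exp (M * x)) w v →
    CloseOnRow i (fun x => c / 2 * Real.exp (M * x)) (P.step n Φ₀ w w') (P.step n Φ₀ v v') := by
  obtain ⟨C, hC0, hC⟩ := exists_rhs_sub_le P n hW
  have hl0 := hpos 0
  -- `6 = 2 * 3`: a bottom value of `K` adds two transport terms to its own one.
  refine ⟨6 * C / P.lam 0, by positivity, ?_⟩
  set M := 6 * C / P.lam 0 with hM
  have hM0 : 0 < M := by positivity
  intro i w v w' v' c hw hv hw' hv' hbd hvw' hc hclose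
  have hMl : 6 * C ≤ M * P.lam i := by
    have h1 := hmono.monotone (Fin.zero_le i)
    calc 6 * C = M * P.lam 0 := by rw [hM]; field_simp
      _ ≤ M * P.lam i := by gcongr
  have htr : ∀ k x y, (x, y) ∈ k.dom → ∀ j, |P.transport n k w w' i j x y -
      P.transport n k v v' i j x y| ≤ c / 6 * Real.exp (M * x) := by
    intro k x y hp j
    unfold transport
    rw [← intervalIntegral.integral_sub (intervalIntegrable_rhs_path hpos hmono hw hw' hp i j)
      (intervalIntegrable_rhs_path hpos hmono hv hv' hp i j)]
    refine (abs_integral_le_exp hM0 (hpos i) (mul_nonneg hC0.le hc)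
      (exitTime_nonneg hpos hmono hp i j) (x := x) fun s hs => ?_).trans ?_
    · rw [mul_assoc]
      exact hC i w v w' v' _ hw hv hbd hvw' hclose k _ _ (path_mem_dom hpos hmono hp i j hs) j
    · rw [div_le_iff₀ (mul_pos hM0 (hpos i))]
      have := mul_le_mul_of_nonneg_left hMl (by positivity : 0 ≤ c / 6 * Real.exp (M * x))
      linarith
  have hmonoexp : ∀ {z x : ℝ}, z ≤ x → c / 6 * Real.exp (M * z) ≤ c / 6 * Real.exp (M * x) := by
    intro z x hzx
    gcongr
  intro k x y hp j
  have h1 := htr k x y hp j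
  have hE : 0 ≤ c / 6 * Real.exp (M * x) := by positivity
  simp only [step, stepWith_apply]
  cases k
  · obtain ⟨hX0, hX1⟩ := exitX_mem hpos hmono hp i j
    by_cases hd : P.FromDiag i j x y
    · rw [inflow_K_of_fromDiag hd, inflow_K_of_fromDiag hd, add_sub_add_left_eq_sub]
      linarith
    · rw [inflow_K_of_not_fromDiag hd, inflow_K_of_not_fromDiag hd]
      have hX2 := hX1.trans hp.2.2
      have h2 := (htr .Phi _ _ (bottom_mem_dom .Phi hX0 hX2) j).trans (hmonoexp hX1)
      have h3 := (htr .L _ _ (bottom_mem_dom .L hX0 hX2) j).trans (hmonoexp hX1)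
      simp only [stepWith_apply, inflow]
      rw [abs_le] at h1 h2 h3 ⊢
      constructor <;> linarith
  · simp only [inflow]
    rw [add_sub_add_left_eq_sub]
    linarith
  · simp only [inflow]
    rw [add_sub_add_left_eq_sub]
    linarith

end PlateParams

/-! ### Fixed points -/

namespace PlateParams

open KernelFamily Filter Topology

variable {P : PlateParams} {n : ℕ} {Φ₀ : Mat3}

/-- The integral form of the kernel equations: each entry is its boundary value plus the integral of
the right-hand side along the characteristic. The factor on the right of `Ω` is taken from `w'`, so
that the kernel equations themselves are the case `w' = w`. -/
def IsIntegralSolution (P : PlateParams) (n : ℕ) (Φ₀ : Mat3) (w w' : KernelFamily) : Prop :=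
  ∀ k x y, (x, y) ∈ k.dom → ∀ i j,
    w k x y i j = P.inflow n Φ₀ w k i j x y + P.transport n k w w' i j x y

lemma IsIntegralSolution.closeOnRow_step (hpos : ∀ i, 0 < P.lam i) (hmono : StrictMono P.lam)
    {w w' : KernelFamily} (h : P.IsIntegralSolution n Φ₀ w w') (i : Fin 3) :
    CloseOnRow i 0 w (P.step n Φ₀ w w') := by
  intro k x y hp j
  rw [h k x y hp i j, step, stepWith_apply, Pi.zero_apply, abs_nonpos_iff, sub_eq_zero]
  cases k
  · by_cases hd : P.FromDiag i j x y
    · rw [inflow_K_of_fromDiag hd, inflow_K_of_fromDiag hd]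
    · obtain ⟨hX0, hX1⟩ := exitX_mem hpos hmono hp i j
      rw [inflow_K_of_not_fromDiag hd, inflow_K_of_not_fromDiag hd,
        h _ _ _ (bottom_mem_dom .Phi hX0 (hX1.trans hp.2.2)),
        h _ _ _ (bottom_mem_dom .L hX0 (hX1.trans hp.2.2))]
      rfl
  · rfl
  · rfl

lemma isIntegralSolution_of_closeOnRow_step (hpos : ∀ i, 0 < P.lam i)
    (hmono : StrictMono P.lam) {w w' : KernelFamily}
    (h : ∀ i, CloseOnRow i 0 w (P.step n Φ₀ w w')) : P.IsIntegralSolution n Φ₀ w w' := by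
  have h' : ∀ k x y, (x, y) ∈ k.dom → ∀ i j, w k x y i j = P.step n Φ₀ w w' k x y i j :=
    fun k x y hp i j => sub_eq_zero.1 (abs_nonpos_iff.1 (h i k x y hp j))
  intro k x y hp i j
  refine (h' k x y hp i j).trans ?_
  rw [step, stepWith_apply]
  cases k
  · by_cases hd : P.FromDiag i j x y
    · rw [inflow_K_of_fromDiag hd, inflow_K_of_fromDiag hd]
    · obtain ⟨hX0, hX1⟩ := exitX_mem hpos hmono hp i j
      rw [inflow_K_of_not_fromDiag hd, inflow_K_of_not_fromDiag hd,
        h' _ _ _ (bottom_mem_dom .Phi hX0 (hX1.trans hp.2.2)),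
        h' _ _ _ (bottom_mem_dom .L hX0 (hX1.trans hp.2.2))]
      rfl
  · rfl
  · rfl

lemma le_zero_of_forall_le_div_two_pow {a c E : ℝ} (h : ∀ m : ℕ, a ≤ c / 2 ^ m * E) : a ≤ 0 := by
  have h1 : Tendsto (fun m : ℕ => c / 2 ^ m * E) atTop (𝓝 (0 * E)) :=
    (tendsto_const_nhds.div_atTop (tendsto_pow_atTop_atTop_of_one_lt one_lt_two)).mul_const E
  rw [zero_mul] at h1
  exact ge_of_tendsto h1 (Eventually.of_forall h)

lemma zero_le_fst_of_mem_dom {k : KernelKind} {x y : ℝ} (hp : (x, y) ∈ k.dom) : 0 ≤ x :=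
  (k.dom_subset_tri hp).1.trans (k.dom_subset_tri hp).2.1

/-- Row `i` of an integral solution is determined by the rows below `i` of the second argument. -/
lemma IsIntegralSolution.closeOnRow_zero (hpos : ∀ i, 0 < P.lam i) (hmono : StrictMono P.lam)
    {w v w' v' : KernelFamily} (hw : w.Admissible) (hv : v.Admissible) (hw' : w'.Admissible)
    (hv' : v'.Admissible) (h : P.IsIntegralSolution n Φ₀ w w')
    (g : P.IsIntegralSolution n Φ₀ v v') {i : Fin 3} (hvw' : ∀ m, i < m → CloseOnRow m 0 w' v') :
    CloseOnRow i 0 w v := by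
  obtain ⟨W', hW'0, hW'⟩ := hw'.bounded
  obtain ⟨M, hM0, hM⟩ := exists_step_contraction (P := P) n Φ₀ hpos hmono hW'0
  obtain ⟨W, hW0, hW⟩ := hw.bounded
  obtain ⟨V, hV0, hV⟩ := hv.bounded
  have key : ∀ m : ℕ, CloseOnRow i (fun x => (W + V) / 2 ^ m * Real.exp (M * x)) w v := by
    intro m
    induction m with
    | zero =>
      intro k x y hp j
      have hexp : 1 ≤ Real.exp (M * x) :=
        Real.one_le_exp (mul_nonneg hM0.le (zero_le_fst_of_mem_dom hp))
      rw [pow_zero, div_one]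
      refine ((abs_sub _ _).trans (add_le_add (hW k x y hp i j) (hV k x y hp i j))).trans ?_
      exact le_mul_of_one_le_right (by positivity) hexp
    | succ m ih =>
      have h1 := hM i w v w' v' _ hw hv hw' hv' hW' hvw' (by positivity) ih
      refine (((h.closeOnRow_step hpos hmono i).triangle h1).triangle
        (g.closeOnRow_step hpos hmono i).symm).mono fun x => le_of_eq ?_
      simp only [Pi.zero_apply]
      rw [pow_succ]
      field_simp
      ring
  intro k x y hp j
  exact le_zero_of_forall_le_div_two_pow fun m => key m k x y hp j

lemma IsIntegralSolution.unique (hpos : ∀ i, 0 < P.lam i) (hmono : StrictMono P.lam)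
    {w v : KernelFamily} (hw : w.Admissible) (hv : v.Admissible)
    (h : P.IsIntegralSolution n Φ₀ w w) (g : P.IsIntegralSolution n Φ₀ v v) (i : Fin 3) :
    CloseOnRow i 0 w v := by
  have h2 : CloseOnRow 2 0 w v := h.closeOnRow_zero hpos hmono hw hv hw hv g fun m hm => by
    exact absurd hm (not_lt.2 (Fin.le_last m))
  have h1 : CloseOnRow 1 0 w v := h.closeOnRow_zero hpos hmono hw hv hw hv g fun m hm => by
    obtain rfl : m = 2 := by omega
    exact h2
  have h0 : CloseOnRow 0 0 w v := h.closeOnRow_zero hpos hmono hw hv hw hv g fun m hm => by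
    obtain rfl | rfl : m = 1 ∨ m = 2 := by omega
    · exact h1
    · exact h2
  fin_cases i
  · exact h0
  · exact h1
  · exact h2

/-- For a given second argument the problem is affine, and Picard iteration solves it. -/
lemma exists_isIntegralSolution_of_snd (n : ℕ) (Φ₀ : Mat3) (hpos : ∀ i, 0 < P.lam i)
    (hmono : StrictMono P.lam) {w' : KernelFamily} (hw' : w'.Admissible) :
    ∃ w : KernelFamily, w.Admissible ∧ P.IsIntegralSolution n Φ₀ w w' := by
  classical
  obtain ⟨W', hW'0, hW'⟩ := hw'.bounded
  obtain ⟨M, hM0, hM⟩ := exists_step_contraction (P := P) n Φ₀ hpos hmono hW'0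
  set u : ℕ → KernelFamily := fun m => (fun w => P.step n Φ₀ w w')^[m] 0 with hu
  have hsucc : ∀ m, u (m + 1) = P.step n Φ₀ (u m) w' := fun m =>
    Function.iterate_succ_apply' _ _ _
  have hadm : ∀ m, (u m).Admissible := by
    intro m
    induction m with
    | zero => exact admissible_zero
    | succ m ih => rw [hsucc]; exact admissible_step hpos hmono ih hw'
  have hrefl : ∀ i m, i < m → CloseOnRow m 0 w' w' := fun i m _ k x y _ j => by simp
  obtain ⟨c, hc0, hc⟩ := (hadm 1).bounded
  have hstep : ∀ m i, CloseOnRow i (fun x => c / 2 ^ m * Real.exp (M * x)) (u m) (u (m + 1)) := by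
    intro m i
    induction m with
    | zero =>
      intro k x y hp j
      have hexp : 1 ≤ Real.exp (M * x) :=
        Real.one_le_exp (mul_nonneg hM0.le (zero_le_fst_of_mem_dom hp))
      have h0 : u 0 k x y i j = 0 := rfl
      rw [pow_zero, div_one, h0, zero_sub, abs_neg]
      exact (hc k x y hp i j).trans (le_mul_of_one_le_right hc0 hexp)
    | succ m ih =>
      have h1 := hM i _ _ w' w' _ (hadm m) (hadm (m + 1)) hw' hw' hW' (hrefl i) (by positivity) ih
      rw [← hsucc, ← hsucc] at h1
      refine h1.mono fun x => le_of_eq ?_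
      rw [pow_succ, div_div]
  -- Outside of the domains the iterates are replaced by `0`, so that they converge everywhere.
  have hlim : ∀ (k : KernelKind) (i j : Fin 3) (p : ℝ × ℝ), ∃ a : ℝ,
      Tendsto (fun m => if p ∈ k.dom then u m k p.1 p.2 i j else 0) atTop (𝓝 a) ∧
      (p ∈ k.dom → ∀ m, |u m k p.1 p.2 i j - a| ≤ 2 * c / 2 ^ m * Real.exp (M * p.1)) := by
    intro k i j p
    by_cases hp : p ∈ k.dom
    · simp only [hp, if_true, forall_const]
      have hd : ∀ m, dist (u m k p.1 p.2 i j) (u (m + 1) k p.1 p.2 i j) ≤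
          2 * c * Real.exp (M * p.1) / 2 / 2 ^ m := fun m => by
        refine (hstep m i k p.1 p.2 hp j).trans (le_of_eq ?_)
        field_simp
      obtain ⟨a, ha⟩ := cauchySeq_tendsto_of_complete (cauchySeq_of_le_geometric_two hd)
      refine ⟨a, ha, fun m => ?_⟩
      refine (dist_le_of_le_geometric_two_of_tendsto hd ha m).trans (le_of_eq ?_)
      ring
    · simp only [hp, if_false, false_imp_iff, and_true]
      exact ⟨0, tendsto_const_nhds⟩
  choose a ha ha' using hlim
  set w : KernelFamily := fun k x y => Matrix.of fun i j => a k i j (x, y) with hwdef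
  have hclose : ∀ m i, CloseOnRow i (fun x => 2 * c / 2 ^ m * Real.exp (M * x)) (u m) w :=
    fun m i k x y hp j => ha' k i j (x, y) hp m
  have hw : w.Admissible := by
    constructor
    · intro k i j
      refine measurable_of_tendsto_metrizable
        (f := fun m p => if p ∈ k.dom then u m k p.1 p.2 i j else 0) (fun m => ?_)
        (tendsto_pi_nhds.2 fun p => ha k i j p)
      exact Measurable.ite k.measurableSet_dom ((hadm m).measurable k i j) measurable_const
    · refine ⟨2 * c * Real.exp M, by positivity, fun k x y hp i j => ?_⟩
      have h1 := hclose 0 i k x y hp j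
      have h0 : u 0 k x y i j = 0 := rfl
      rw [h0, zero_sub, abs_neg, pow_zero, div_one] at h1
      refine h1.trans ?_
      exact mul_le_mul_of_nonneg_left (Real.exp_le_exp.2
        (mul_le_of_le_one_right hM0.le (k.dom_subset_tri hp).2.2)) (by positivity)
  refine ⟨w, hw, isIntegralSolution_of_closeOnRow_step hpos hmono fun i k x y hp j => ?_⟩
  refine le_zero_of_forall_le_div_two_pow (c := 2 * c) (E := Real.exp (M * x)) fun m => ?_
  have h1 := hM i _ _ w' w' _ (hadm m) hw hw' hw' hW' (hrefl i) (by positivity) (hclose m i)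
  rw [← hsucc] at h1
  refine ((hclose (m + 1) i).symm.triangle h1 k x y hp j).trans (le_of_eq ?_)
  simp only
  rw [pow_succ]
  field_simp
  ring

variable (P) in
/-- The full problem has an integral solution: when the affine problem is solved repeatedly, each
time with the previous solution as second argument, the last row is stationary from the first
solution on, the middle row from the second and the first row from the third. -/
lemma exists_isIntegralSolution (n : ℕ) (Φ₀ : Mat3) (hpos : ∀ i, 0 < P.lam i)
    (hmono : StrictMono P.lam) :
    ∃ w : KernelFamily, w.Admissible ∧ P.IsIntegralSolution n Φ₀ w w := by
  obtain ⟨w₁, a₁, h₁⟩ := exists_isIntegralSolution_of_snd (P := P) n Φ₀ hpos hmono admissible_zero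
  obtain ⟨w₂, a₂, h₂⟩ := exists_isIntegralSolution_of_snd (P := P) n Φ₀ hpos hmono a₁
  obtain ⟨w₃, a₃, h₃⟩ := exists_isIntegralSolution_of_snd (P := P) n Φ₀ hpos hmono a₂
  obtain ⟨w₄, a₄, h₄⟩ := exists_isIntegralSolution_of_snd (P := P) n Φ₀ hpos hmono a₃
  have vac : ∀ {w v : KernelFamily} (m : Fin 3), 2 < m → CloseOnRow m 0 w v :=
    fun m hm => absurd hm (not_lt.2 (Fin.le_last m))
  have r12 : CloseOnRow 2 0 w₁ w₂ := h₁.closeOnRow_zero hpos hmono a₁ a₂ admissible_zero a₁ h₂ vac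
  have r23 : ∀ m, 0 < m → CloseOnRow m 0 w₂ w₃ := by
    intro m hm
    refine h₂.closeOnRow_zero hpos hmono a₂ a₃ a₁ a₂ h₃ fun m' hm' => ?_
    obtain rfl : m' = 2 := by omega
    exact r12
  have r34 : ∀ m, CloseOnRow m 0 w₃ w₄ := fun m =>
    h₃.closeOnRow_zero hpos hmono a₃ a₄ a₂ a₃ h₄ fun m' hm' => r23 m' (by omega)
  refine ⟨w₄, a₄, isIntegralSolution_of_closeOnRow_step hpos hmono fun i => ?_⟩
  obtain ⟨W, hW0, hW⟩ := a₃.bounded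
  obtain ⟨M, -, hM⟩ := exists_step_contraction (P := P) n Φ₀ hpos hmono hW0
  have h5 := hM i w₄ w₄ w₃ w₄ 0 a₄ a₄ a₃ a₄ hW (fun m _ => r34 m) le_rfl
    fun k x y _ j => by simp
  exact ((h₄.closeOnRow_step hpos hmono i).triangle h5).mono fun x => by simp

end PlateParams

/-! ### Integral solutions and bounded kernel solutions -/

lemma CaratheodoryOn.mono {u g : ℝ → ℝ} {T T' : ℝ} (h : CaratheodoryOn u g T) (h0 : 0 ≤ T')
    (hle : T' ≤ T) : CaratheodoryOn u g T' := by
  refine ⟨h.1.mono ?_, ?_⟩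
  · rw [Set.uIcc_of_le h0, Set.uIcc_of_le (h0.trans hle)]
    exact Set.Icc_subset_Icc_right hle
  · filter_upwards [h.2] with t ht hmem using ht ⟨hmem.1, hmem.2.trans_le hle⟩

lemma affine_nonneg {a b t T : ℝ} (h0 : 0 ≤ a) (hT : 0 ≤ a + b * T) (ht : t ∈ Set.Icc 0 T) :
    0 ≤ a + b * t := by
  rcases le_total 0 b with hb | hb
  · linarith [mul_nonneg hb ht.1]
  · linarith [mul_le_mul_of_nonpos_left ht.2 hb]

lemma segment_mem_tri {x y p q t T : ℝ} (h0 : (x, y) ∈ Tri) (hT : (x + p * T, y + q * T) ∈ Tri)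
    (ht : t ∈ Set.Icc 0 T) : (x + p * t, y + q * t) ∈ Tri := by
  obtain ⟨h1, h2, h3⟩ := h0
  obtain ⟨g1, g2, g3⟩ := hT
  simp only at h1 h2 h3 g1 g2 g3
  have e1 := affine_nonneg h1 g1 ht
  have e2 := affine_nonneg (a := x - y) (b := p - q) (by linarith) (by linarith) ht
  have e3 := affine_nonneg (a := 1 - x) (b := -p) (by linarith) (by linarith) ht
  exact ⟨e1, by simp only; linarith, by simp only; linarith⟩

namespace PlateParams

open KernelFamily

variable {P : PlateParams} {n : ℕ} {Φ₀ : Mat3}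

lemma exitX_shift (hpos : ∀ i, 0 < P.lam i) (hmono : StrictMono P.lam) (k : KernelKind)
    (i j : Fin 3) (x y t : ℝ) :
    P.exitX k i j (x + P.lam i * t) (y + P.vel k j * t) = P.exitX k i j x y := by
  unfold exitX
  rw [exitTime_shift hpos hmono]
  ring

lemma inflow_shift (hpos : ∀ i, 0 < P.lam i) (hmono : StrictMono P.lam) (v : KernelFamily)
    (k : KernelKind) (i j : Fin 3) (x y t : ℝ) :
    P.inflow n Φ₀ v k i j (x + P.lam i * t) (y + P.vel k j * t) =
      P.inflow n Φ₀ v k i j x y := by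
  have hX := exitX_shift hpos hmono k i j x y t
  cases k
  · by_cases hd : P.FromDiag i j x y
    · have hd' : P.FromDiag i j (x + P.lam i * t) (y + P.vel .K j * t) := fromDiag_shift.2 hd
      rw [inflow_K_of_fromDiag hd, inflow_K_of_fromDiag hd', hX]
    · have hd' : ¬P.FromDiag i j (x + P.lam i * t) (y + P.vel .K j * t) :=
        mt fromDiag_shift.1 hd
      rw [inflow_K_of_not_fromDiag hd, inflow_K_of_not_fromDiag hd', hX]
  · simp only [inflow, hX]
  · rfl

/-- Along a characteristic, an integral solution satisfies its differential equation. -/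
lemma IsIntegralSolution.caratheodoryOn (hpos : ∀ i, 0 < P.lam i) (hmono : StrictMono P.lam)
    {w : KernelFamily} (hw : w.Admissible) (h : P.IsIntegralSolution n Φ₀ w w) {k : KernelKind}
    (i j : Fin 3) {x y T : ℝ} (hT : 0 ≤ T)
    (hseg : ∀ t ∈ Set.Icc 0 T, (x + P.lam i * t, y + P.vel k j * t) ∈ k.dom) :
    CaratheodoryOn (fun t => w k (x + P.lam i * t) (y + P.vel k j * t) i j)
      (fun t => P.rhs n k w w (x + P.lam i * t) (y + P.vel k j * t) i j) T := by
  set g : ℝ → ℝ := fun t => P.rhs n k w w (x + P.lam i * t) (y + P.vel k j * t) i j with hg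
  obtain ⟨R, -, hR⟩ := exists_rhs_bound (P := P) (n := n) hw hw
  have hgm : Measurable g := by
    have h1 : Measurable fun t : ℝ => (x + P.lam i * t, y + P.vel k j * t) := by fun_prop
    simpa only [Function.comp_def] using (measurable_rhs (P := P) (n := n) hw hw k i j).comp h1
  have h0 : (x, y) ∈ k.dom := by simpa using hseg 0 ⟨le_rfl, hT⟩
  set τ := P.exitTime k i j x y with hτ
  have hτ0 : 0 ≤ τ := exitTime_nonneg hpos hmono h0 i j
  have hint1 : IntervalIntegrable g volume (-τ) 0 := by
    refine intervalIntegrable_of_abs_le (B := R) (by linarith) hgm fun s hs => ?_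
    have := hR k _ _ (path_mem_dom hpos hmono h0 i j (s := -s)
      ⟨by linarith [hs.2], by linarith [hs.1]⟩) i j
    simpa [hg] using this
  have hint2 : ∀ t ∈ Set.Icc 0 T, IntervalIntegrable g volume 0 t := fun t ht =>
    intervalIntegrable_of_abs_le ht.1 hgm fun s hs =>
      hR k _ _ (hseg s ⟨hs.1, hs.2.trans ht.2⟩) i j
  refine caratheodoryOn_of_eq_integral
    (c := P.inflow n Φ₀ w k i j x y + ∫ s in -τ..0, g s) hT (hint2 T ⟨hT, le_rfl⟩)
    fun t ht => ?_
  rw [h k _ _ (hseg t ht) i j, inflow_shift hpos hmono, add_assoc,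
    intervalIntegral.integral_add_adjacent_intervals hint1 (hint2 t ht), transport,
    exitTime_shift hpos hmono]
  congr 1
  have hsub := intervalIntegral.integral_comp_sub_left (a := 0) (b := τ + t) g t
  rw [show t - (τ + t) = -τ by ring, sub_zero] at hsub
  rw [← hsub]
  refine intervalIntegral.integral_congr fun s _ => ?_
  simp only [hg]
  congr 2 <;> ring

/-- Conversely, a broad solution is the value at the start of the characteristic plus an integral
along it. -/
lemma _root_.IsBroadSolution.eq_add_integral (hpos : ∀ i, 0 < P.lam i)
    (hmono : StrictMono P.lam) {k : KernelKind} {i j : Fin 3} {u g : ℝ → ℝ → ℝ}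
    (h : IsBroadSolution (P.lam i) (P.vel k j) u g) {x y : ℝ} (hp : (x, y) ∈ k.dom) :
    u x y = u (P.exitX k i j x y) (y - P.vel k j * P.exitTime k i j x y) +
      ∫ s in (0 : ℝ)..P.exitTime k i j x y, g (x - P.lam i * s) (y - P.vel k j * s) := by
  set τ := P.exitTime k i j x y with hτ
  have hτ0 : 0 ≤ τ := exitTime_nonneg hpos hmono hp i j
  have h1 := (h (x - P.lam i * τ) (y - P.vel k j * τ) τ hτ0
    (k.dom_subset_tri (path_mem_dom hpos hmono hp i j ⟨hτ0, le_rfl⟩))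
    (by simpa using k.dom_subset_tri hp)).eq_add_integral hτ0
  simp only [sub_add_cancel, mul_zero, add_zero] at h1
  rw [h1, exitX]
  congr 1
  have hsub := intervalIntegral.integral_comp_sub_left (a := 0) (b := τ)
    (fun s => g (x - P.lam i * s) (y - P.vel k j * s)) τ
  rw [sub_self, sub_zero] at hsub
  rw [← hsub]
  refine intervalIntegral.integral_congr fun s _ => ?_
  congr 1 <;> ring

lemma Sig_inv (hpos : ∀ i, 0 < P.lam i) : P.Sig⁻¹ = Matrix.diagonal fun i => (P.lam i)⁻¹ := by
  refine Matrix.inv_eq_left_inv ?_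
  rw [Sig, Matrix.diagonal_mul_diagonal, ← Matrix.diagonal_one]
  congr 1
  ext i
  exact inv_mul_cancel₀ (hpos i).ne'

lemma Sig_inv_mul_apply (hpos : ∀ i, 0 < P.lam i) (X : Mat3) (i j : Fin 3) :
    (P.Sig⁻¹ * X) i j = (P.lam i)⁻¹ * X i j := by
  rw [Sig_inv hpos, Matrix.diagonal_mul]

lemma rhsPhi_apply (hpos : ∀ i, 0 < P.lam i) (w : KernelFamily) (x : ℝ) (i j : Fin 3) :
    P.rhsPhi n (w .K) (w .L) (fun x => w .Phi x 0) x i j =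
      (P.lam i)⁻¹ * P.rhs n .Phi w w x 0 i j := by
  simp only [rhsPhi, rhs, Matrix.mul_assoc, Matrix.add_apply, Matrix.sub_apply, Matrix.of_apply,
    Sig_inv_mul_apply hpos, coeffLead, coeffL, weightK, weightL, KernelKind.lead,
    intervalIntegral.integral_const_mul]
  ring

lemma transport_phi (hpos : ∀ i, 0 < P.lam i) (w : KernelFamily) (x : ℝ) (i j : Fin 3) :
    P.transport n .Phi w w i j x 0 =
      ∫ s in (0 : ℝ)..x, P.rhsPhi n (w .K) (w .L) (fun x => w .Phi x 0) s i j := by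
  have hi := (hpos i).ne'
  simp only [rhsPhi_apply hpos, intervalIntegral.integral_const_mul]
  have h := intervalIntegral.integral_comp_sub_mul (a := 0) (b := x / P.lam i)
    (fun s => P.rhs n .Phi w w s 0 i j) hi x
  rw [mul_div_cancel₀ _ hi, sub_self, mul_zero, sub_zero, smul_eq_mul] at h
  rw [← h]
  simp [transport, exitTime, vel]

lemma F11_add_F12_of_le (x : ℝ) {i j : Fin 3} (h : i ≤ j) :
    (P.F11 n x + P.F12 x) i j = P.Om n 0 x i j := by
  revert h
  fin_cases i <;> fin_cases j <;> simp [F11, F12, Om]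

lemma C_eq : PlateParams.C = -1 := by
  ext i j
  fin_cases i <;> fin_cases j <;> simp [C]

lemma Sig_mul_apply (X : Mat3) (i j : Fin 3) : (P.Sig * X) i j = P.lam i * X i j :=
  Matrix.diagonal_mul _ _ _ _

lemma mul_Sig_apply (X : Mat3) (i j : Fin 3) : (X * P.Sig) i j = X i j * P.lam j :=
  Matrix.mul_diagonal _ _ _ _

lemma diag_mem_tri {x : ℝ} (hx : x ∈ Set.Icc (0 : ℝ) 1) : (x, x) ∈ Tri :=
  ⟨hx.1, le_rfl, hx.2⟩

lemma transport_of_exitTime_eq_zero {k : KernelKind} {w : KernelFamily} {i j : Fin 3} {x y : ℝ}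
    (h : P.exitTime k i j x y = 0) : P.transport n k w w i j x y = 0 := by
  rw [transport, h, intervalIntegral.integral_same]

lemma exitX_of_exitTime_eq_zero {k : KernelKind} {i j : Fin 3} {x y : ℝ}
    (h : P.exitTime k i j x y = 0) : P.exitX k i j x y = x := by
  rw [exitX, h, mul_zero, sub_zero]

/-- An integral solution is a bounded solution in the sense of the kernel equations. -/
lemma IsIntegralSolution.isBoundedKernelSolution (hpos : ∀ i, 0 < P.lam i)
    (hmono : StrictMono P.lam) {w : KernelFamily} (hw : w.Admissible)
    (h : P.IsIntegralSolution n Φ₀ w w) :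
    IsBoundedKernelSolution P n Φ₀ (w .K) (w .L) (fun x => w .Phi x 0) where
  measurable_K i j := (hw.measurable .K i j).comp measurable_subtype_coe
  measurable_L i j := (hw.measurable .L i j).comp measurable_subtype_coe
  bounded := by
    obtain ⟨B, -, hB⟩ := hw.bounded
    exact ⟨B, fun i j => ⟨fun x y hp => ⟨hB .K x y hp i j, hB .L x y hp i j⟩,
      fun x hx => hB .Phi x 0 (bottom_mem_dom .Phi hx.1 hx.2) i j⟩⟩
  eq_L i j x y T hT h0 h1 := h.caratheodoryOn hpos hmono hw (k := .L) i j hT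
    fun t ht => segment_mem_tri h0 h1 ht
  eq_K i j x y T hT h0 h1 := h.caratheodoryOn hpos hmono hw (k := .K) i j hT
    fun t ht => segment_mem_tri h0 h1 ht
  eq_Phi i j := by
    obtain ⟨R, -, hR⟩ := exists_rhs_bound (P := P) (n := n) hw hw
    refine caratheodoryOn_of_eq_integral (c := Φ₀ i j) zero_le_one ?_ fun x hx => ?_
    · simp only [rhsPhi_apply hpos]
      refine IntervalIntegrable.const_mul ?_ _
      have hm := (measurable_rhs (P := P) (n := n) hw hw .Phi i j).comp
        (measurable_id.prodMk measurable_const : Measurable fun s : ℝ => (s, (0 : ℝ)))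
      exact intervalIntegrable_of_abs_le zero_le_one hm fun s hs =>
        hR .Phi s 0 (bottom_mem_dom .Phi hs.1 hs.2) i j
    · rw [← transport_phi hpos, h .Phi x 0 (bottom_mem_dom .Phi hx.1 hx.2) i j]
      rfl
  bc_L_diag x hx := by
    ext i j
    have hτ : P.exitTime .L i j x x = 0 := by simp [exitTime]
    have hij : P.lam i + P.lam j ≠ 0 := (add_pos (hpos i) (hpos j)).ne'
    rw [Matrix.add_apply, Sig_mul_apply, mul_Sig_apply, Matrix.neg_apply,
      h .L x x (diag_mem_tri hx) i j, transport_of_exitTime_eq_zero hτ]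
    simp only [inflow, exitX_of_exitTime_eq_zero hτ]
    field_simp
    ring
  bc_K_diag x hx := by
    ext i j
    rw [Matrix.sub_apply, Sig_mul_apply, mul_Sig_apply, Matrix.add_apply]
    rcases le_or_gt i j with hij | hij
    · rw [Matrix.neg_apply, F11_add_F12_of_le x hij, Om_apply (w .K)]
      split_ifs with hlt
      · ring
      · obtain rfl : i = j := le_antisymm hij (not_lt.1 hlt)
        ring
    · have hd : P.FromDiag i j x x := ⟨hij, mul_le_mul_of_nonneg_right (hmono hij).le hx.1⟩
      have hτ : P.exitTime .K i j x x = 0 := by simp [exitTime_K_of_fromDiag hd]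
      have hlam : P.lam i - P.lam j ≠ 0 := (sub_pos.2 (hmono hij)).ne'
      rw [Om_apply_of_le _ _ hij.le, Matrix.neg_apply, h .K x x (diag_mem_tri hx) i j,
        transport_of_exitTime_eq_zero hτ, inflow_K_of_fromDiag hd, exitX_of_exitTime_eq_zero hτ]
      field_simp
      ring
  bc_K_bottom x hx i j hij := by
    have hd : ¬P.FromDiag i j x 0 := by
      rintro ⟨h1, h2⟩
      rcases hij with h3 | h3
      · have := mul_pos (hpos j) h3
        linarith
      · exact absurd h1 (not_lt.2 h3)
    have hτ : P.exitTime .K i j x 0 = 0 := by simp [exitTime_K_of_not_fromDiag hd]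
    rw [C_eq, mul_neg, mul_one, sub_neg_eq_add, Matrix.add_apply, mul_Sig_apply, mul_Sig_apply,
      mul_Sig_apply, h .K x 0 (bottom_mem_dom .K hx.1 hx.2) i j,
      transport_of_exitTime_eq_zero hτ, inflow_K_of_not_fromDiag hd, exitX_of_exitTime_eq_zero hτ]
    ring
  init_Phi := by
    ext i j
    have hτ : P.exitTime .Phi i j 0 0 = 0 := by simp [exitTime]
    rw [h .Phi 0 0 (bottom_mem_dom .Phi le_rfl zero_le_one) i j, transport_of_exitTime_eq_zero hτ,
      add_zero]
    rfl

open Classical in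
/-- The triple `(K, L, Φ)` as a family, with every kernel replaced by `0` outside of its domain. -/
noncomputable def ofTriple (K L : ℝ → ℝ → Mat3) (Φ : ℝ → Mat3) : KernelFamily :=
  fun k x y => if (x, y) ∈ k.dom then
    match k with
    | .K => K x y
    | .L => L x y
    | .Phi => Φ x
  else 0

section ofTriple

variable {K L : ℝ → ℝ → Mat3} {Φ : ℝ → Mat3}

lemma ofTriple_K {x y : ℝ} (hp : (x, y) ∈ Tri) : ofTriple K L Φ .K x y = K x y := if_pos hp

lemma ofTriple_L {x y : ℝ} (hp : (x, y) ∈ Tri) : ofTriple K L Φ .L x y = L x y := if_pos hp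

lemma ofTriple_Phi {x : ℝ} (hx : x ∈ Set.Icc (0 : ℝ) 1) : ofTriple K L Φ .Phi x 0 = Φ x :=
  if_pos (bottom_mem_dom .Phi hx.1 hx.2)

lemma ofTriple_of_notMem {k : KernelKind} {x y : ℝ} (hp : (x, y) ∉ k.dom) :
    ofTriple K L Φ k x y = 0 := if_neg hp

lemma admissible_ofTriple (h : IsBoundedKernelSolution P n Φ₀ K L Φ) :
    (ofTriple K L Φ).Admissible where
  measurable k i j := by
    refine measurable_of_restrict_of_restrict_compl k.measurableSet_dom ?_ ?_
    · cases k
      · have e : (KernelKind.K.dom.domRestrict fun p : ℝ × ℝ => ofTriple K L Φ .K p.1 p.2 i j) =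
            fun p => K p.1.1 p.1.2 i j :=
          funext fun p => congrFun₂ (ofTriple_K p.2 : ofTriple K L Φ .K p.1.1 p.1.2 = _) i j
        rw [e]
        exact h.measurable_K i j
      · have e : (KernelKind.L.dom.domRestrict fun p : ℝ × ℝ => ofTriple K L Φ .L p.1 p.2 i j) =
            fun p => L p.1.1 p.1.2 i j :=
          funext fun p => congrFun₂ (ofTriple_L p.2 : ofTriple K L Φ .L p.1.1 p.1.2 = _) i j
        rw [e]
        exact h.measurable_L i j
      · have hc := (h.eq_Phi i j).1.continuousOn
        rw [Set.uIcc_of_le zero_le_one, continuousOn_iff_continuous_domRestrict] at hc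
        have hm : Measurable fun p : KernelKind.Phi.dom =>
            (⟨p.1.1, (mem_dom_phi.1 p.2).1⟩ : Set.Icc (0 : ℝ) 1) :=
          (measurable_fst.comp measurable_subtype_coe).subtype_mk
        have e : (KernelKind.Phi.dom.domRestrict fun p : ℝ × ℝ =>
            ofTriple K L Φ .Phi p.1 p.2 i j) = fun p => Φ p.1.1 i j :=
          funext fun p => congrFun₂ (if_pos p.2 : ofTriple K L Φ .Phi p.1.1 p.1.2 = Φ p.1.1) i j
        rw [e]
        exact hc.measurable.comp hm
    · have e : (k.domᶜ.domRestrict fun p : ℝ × ℝ => ofTriple K L Φ k p.1 p.2 i j) =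
          fun _ => 0 :=
        funext fun p => congrFun₂
          (ofTriple_of_notMem p.2 : ofTriple K L Φ k p.1.1 p.1.2 = 0) i j
      rw [e]
      exact measurable_const
  bounded := by
    obtain ⟨B, hB⟩ := h.bounded
    refine ⟨|B|, abs_nonneg _, fun k x y hp i j => ?_⟩
    cases k
    · rw [ofTriple_K hp]
      exact (((hB i j).1 x y hp).1).trans (le_abs_self _)
    · rw [ofTriple_L hp]
      exact (((hB i j).1 x y hp).2).trans (le_abs_self _)
    · obtain ⟨hx, rfl⟩ := mem_dom_phi.1 hp
      rw [ofTriple_Phi hx]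
      exact ((hB i j).2 x hx).trans (le_abs_self _)

lemma Om_ofTriple {x : ℝ} (hx : x ∈ Set.Icc (0 : ℝ) 1) :
    P.Om n (ofTriple K L Φ .K) x = P.Om n K x := by
  simp only [Om, ofTriple_K (diag_mem_tri hx)]

lemma rhs_ofTriple_K {x y : ℝ} (hp : (x, y) ∈ Tri) :
    P.rhs n .K (ofTriple K L Φ) (ofTriple K L Φ) x y = P.rhsK n K L x y := by
  have hx : x ∈ Set.Icc (0 : ℝ) 1 := ⟨hp.1.trans hp.2.1, hp.2.2⟩
  simp only [rhs, rhsK, KernelKind.lead, coeffLead, coeffL, weightK, weightL, ofTriple_K hp,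
    ofTriple_L hp, Om_ofTriple hx]
  congr 2
  ext i j
  refine intervalIntegral.integral_congr fun s hs => ?_
  rw [Set.uIcc_of_le hp.2.1] at hs
  have hs' := (mem_tri_of_mem_Icc hp hs).1
  simp only [ofTriple_K hs', ofTriple_L hs']

lemma rhs_ofTriple_L {x y : ℝ} (hp : (x, y) ∈ Tri) :
    P.rhs n .L (ofTriple K L Φ) (ofTriple K L Φ) x y = P.rhsL n K L x y := by
  have hx : x ∈ Set.Icc (0 : ℝ) 1 := ⟨hp.1.trans hp.2.1, hp.2.2⟩
  simp only [rhs, rhsL, KernelKind.lead, coeffLead, coeffL, weightK, weightL, ofTriple_K hp,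
    ofTriple_L hp, Om_ofTriple hx]
  congr 2
  ext i j
  refine intervalIntegral.integral_congr fun s hs => ?_
  rw [Set.uIcc_of_le hp.2.1] at hs
  have hs' := (mem_tri_of_mem_Icc hp hs).1
  simp only [ofTriple_K hs', ofTriple_L hs']

lemma rhsPhi_ofTriple {x : ℝ} (hx : x ∈ Set.Icc (0 : ℝ) 1) :
    P.rhsPhi n (ofTriple K L Φ .K) (ofTriple K L Φ .L) (fun x => ofTriple K L Φ .Phi x 0) x =
      P.rhsPhi n K L Φ x := by
  have hp : (x, 0) ∈ Tri := ⟨le_rfl, hx⟩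
  simp only [rhsPhi, ofTriple_L hp, ofTriple_Phi hx, Om_ofTriple hx]
  congr 2
  ext i j
  refine intervalIntegral.integral_congr fun s hs => ?_
  rw [Set.uIcc_of_le hx.1] at hs
  have hs' := (mem_tri_of_mem_Icc hp hs).1
  simp only [ofTriple_K hs', ofTriple_L hs']

/-- A bounded solution of the kernel equations solves them in integral form. -/
lemma _root_.IsBoundedKernelSolution.isIntegralSolution (hpos : ∀ i, 0 < P.lam i)
    (hmono : StrictMono P.lam) (h : IsBoundedKernelSolution P n Φ₀ K L Φ) :
    P.IsIntegralSolution n Φ₀ (ofTriple K L Φ) (ofTriple K L Φ) := by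
  intro k x y hp i j
  obtain ⟨hX0, hX1⟩ := exitX_mem hpos hmono hp i j
  have hX : P.exitX k i j x y ∈ Set.Icc (0 : ℝ) 1 := ⟨hX0, hX1.trans (k.dom_subset_tri hp).2.2⟩
  have hτ := exitTime_nonneg hpos hmono hp i j
  have hi := hpos i
  have hj := hpos j
  cases k
  · rw [ofTriple_K hp, (h.eq_K i j).eq_add_integral hpos hmono (k := .K) hp, transport]
    congr 1
    · by_cases hd : P.FromDiag i j x y
      · have hlt := sub_pos.2 (hmono hd.1)
        have hy : y - P.vel .K j * P.exitTime .K i j x y = P.exitX .K i j x y := by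
          simp only [exitX, vel, exitTime_K_of_fromDiag hd]
          field_simp
          ring
        have hbc := congrFun₂ (h.bc_K_diag _ hX) i j
        rw [Matrix.sub_apply, Sig_mul_apply, mul_Sig_apply, Matrix.add_apply, Matrix.neg_apply,
          Om_apply_of_le _ _ hd.1.le] at hbc
        rw [inflow_K_of_fromDiag hd, hy, eq_div_iff hlt.ne']
        linarith
      · have hy : y - P.vel .K j * P.exitTime .K i j x y = 0 := by
          simp only [vel, exitTime_K_of_not_fromDiag hd]
          field_simp
          ring
        have hcond : 0 < P.exitX .K i j x y ∨ i ≤ j := by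
          rcases le_or_gt i j with hij | hij
          · exact Or.inr hij
          · left
            have hlt : P.lam i * y < P.lam j * x := by
              by_contra hcon
              exact hd ⟨hij, not_lt.1 hcon⟩
            rw [exitX, exitTime_K_of_not_fromDiag hd, sub_pos, ← mul_div_assoc, div_lt_iff₀ hj]
            linarith
        have hbc := h.bc_K_bottom _ hX i j hcond
        rw [C_eq, mul_neg, mul_one, sub_neg_eq_add, Matrix.add_apply, mul_Sig_apply,
          mul_Sig_apply, mul_Sig_apply, ← add_mul] at hbc
        have hbc' := mul_right_cancel₀ hj.ne' hbc
        rw [inflow_K_of_not_fromDiag hd, hy, ofTriple_Phi hX,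
          ofTriple_L (bottom_mem_dom .L hX.1 hX.2)]
        linarith
    · refine intervalIntegral.integral_congr fun s hs => ?_
      rw [Set.uIcc_of_le hτ] at hs
      exact congrFun₂ (rhs_ofTriple_K (path_mem_dom hpos hmono hp i j hs)).symm i j
  · rw [ofTriple_L hp, (h.eq_L i j).eq_add_integral hpos hmono (k := .L) hp, transport]
    congr 1
    · have hij := add_pos hi hj
      have hy : y - P.vel .L j * P.exitTime .L i j x y = P.exitX .L i j x y := by
        simp only [exitX, vel, exitTime]
        field_simp
        ring
      have hbc := congrFun₂ (h.bc_L_diag _ hX) i j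
      rw [Matrix.add_apply, Sig_mul_apply, mul_Sig_apply, Matrix.neg_apply] at hbc
      simp only [inflow]
      rw [hy, eq_div_iff hij.ne']
      linarith
    · refine intervalIntegral.integral_congr fun s hs => ?_
      rw [Set.uIcc_of_le hτ] at hs
      exact congrFun₂ (rhs_ofTriple_L (path_mem_dom hpos hmono hp i j hs)).symm i j
  · obtain ⟨hx, rfl⟩ := mem_dom_phi.1 hp
    have h1 := ((h.eq_Phi i j).mono hx.1 hx.2).eq_add_integral hx.1
    rw [ofTriple_Phi hx, h1, h.init_Phi, transport_phi hpos]
    congr 1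
    refine intervalIntegral.integral_congr fun s hs => ?_
    rw [Set.uIcc_of_le hx.1] at hs
    exact congrFun₂ (rhsPhi_ofTriple ⟨hs.1, hs.2.trans hx.2⟩).symm i j

end ofTriple

lemma lam_pos (hε : 0 < P.ε) (hμ₁ : 0 < P.μ₁) (hμ₂ : 0 < P.μ₂) (i : Fin 3) : 0 < P.lam i := by
  fin_cases i
  · exact one_div_pos.2 (Real.sqrt_pos.2 hε)
  · exact one_div_pos.2 (Real.sqrt_pos.2 hμ₁)
  · exact one_div_pos.2 (Real.sqrt_pos.2 hμ₂)

lemma strictMono_lam (h₁₂ : 1 / √P.ε < 1 / √P.μ₁) (h₂₃ : 1 / √P.μ₁ < 1 / √P.μ₂) :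
    StrictMono P.lam := by
  refine Fin.strictMono_iff_lt_succ.2 fun i => ?_
  fin_cases i
  · exact h₁₂
  · exact h₂₃

end PlateParams

theorem theorem1 (P : PlateParams) (n : ℕ) (δ₁ δ₂ δ₃ b : ℝ)
    (hε : 0 < P.ε) (hμ₁ : 0 < P.μ₁) (hμ₂ : 0 < P.μ₂) (ha : 0 < P.a) (hℓ : 0 < P.ℓ)
    (h₁₂ : 1 / √P.ε < 1 / √P.μ₁) (h₂₃ : 1 / √P.μ₁ < 1 / √P.μ₂)
    (hδ₁ : 0 < δ₁) (hδ₂ : 0 < δ₂) (hδ₃ : 0 < δ₃) :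
    ∃ (K L : ℝ → ℝ → Mat3) (Φ : ℝ → Mat3),
      IsBoundedKernelSolution P n (P.Phi0 δ₁ δ₂ δ₃ b) K L Φ ∧
      (∀ (K' L' : ℝ → ℝ → Mat3) (Φ' : ℝ → Mat3),
        IsBoundedKernelSolution P n (P.Phi0 δ₁ δ₂ δ₃ b) K' L' Φ' →
          (∀ x y, (x, y) ∈ Tri → K' x y = K x y ∧ L' x y = L x y) ∧
            ∀ x ∈ Set.Icc (0 : ℝ) 1, Φ' x = Φ x) ∧
      ∃ M : ℝ, 0 < M ∧ ∀ i j,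
        (∀ x y, (x, y) ∈ Tri →
          |K x y i j| ≤ M * Real.exp (M * x) ∧ |L x y i j| ≤ M * Real.exp (M * x)) ∧
        ∀ x ∈ Set.Icc (0 : ℝ) 1, |Φ x i j| ≤ M * Real.exp (M * x) := by
  have hpos := PlateParams.lam_pos hε hμ₁ hμ₂
  have hmono := PlateParams.strictMono_lam h₁₂ h₂₃
  obtain ⟨w, hw, hsol⟩ := P.exists_isIntegralSolution n (P.Phi0 δ₁ δ₂ δ₃ b) hpos hmono
  refine ⟨w .K, w .L, fun x => w .Phi x 0, hsol.isBoundedKernelSolution hpos hmono hw, ?_, ?_⟩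
  · intro K' L' Φ' h'
    have heq : ∀ k x y, (x, y) ∈ k.dom → PlateParams.ofTriple K' L' Φ' k x y = w k x y := by
      intro k x y hp
      ext i j
      exact sub_eq_zero.1 (abs_nonpos_iff.1
        ((h'.isIntegralSolution hpos hmono).unique hpos hmono (PlateParams.admissible_ofTriple h')
          hw hsol i k x y hp j))
    refine ⟨fun x y hp => ⟨?_, ?_⟩, fun x hx => ?_⟩
    · rw [← heq .K x y hp, PlateParams.ofTriple_K hp]
    · rw [← heq .L x y hp, PlateParams.ofTriple_L hp]
    · exact (PlateParams.ofTriple_Phi hx).symm.trans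
        (heq .Phi x 0 (PlateParams.bottom_mem_dom .Phi hx.1 hx.2))
  · obtain ⟨B, hB0, hB⟩ := hw.bounded
    have hM : 0 < B + 1 := by linarith
    -- On `[0, 1]` the exponential factor is at least `1`, so a uniform bound is enough.
    have hle : ∀ {x : ℝ}, 0 ≤ x → B ≤ (B + 1) * Real.exp ((B + 1) * x) := fun {x} hx => by
      have := le_mul_of_one_le_right hM.le (Real.one_le_exp (mul_nonneg hM.le hx))
      linarith
    refine ⟨B + 1, hM, fun i j => ⟨fun x y hp => ⟨?_, ?_⟩, fun x hx => ?_⟩⟩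
    · exact (hB .K x y hp i j).trans (hle (hp.1.trans hp.2.1))
    · exact (hB .L x y hp i j).trans (hle (hp.1.trans hp.2.1))
    · exact (hB .Phi x 0 (PlateParams.bottom_mem_dom .Phi hx.1 hx.2) i j).trans (hle hx.1)
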